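/- **Model.** There are $m\ge 1$ quality levels $\bar\omega_1<\dots<\bar\omega_m$ in $[0,1]$ with a known prior $\lambda$, a price cap $U>0$, and buyer types in $\Theta=[0,1]$ with an unknown law with CDF $F$ such that $\Pr[\theta=1]=0$ (otherwise arbitrary; no smoothness or continuity is assumed). The valuation $v:[0,1]^2\to\mathbb R$, $(\theta,q)\mapsto v(\theta,q)$, is affine and non-decreasing in $q$, and strictly increasing and $1$-Lipschitz in $\theta$. In each of $T$ rounds the seller posts a price $p_t\in[0,U]$ and an advertising strategy $\rho_t=(\rho_{i,t})_{i\le m}$, where $\rho_{i}$ is a probability law on $[0,1]$ of the announced posterior mean at quality $\bar\omega_i$, subject to Bayes consistency $\sum_i\lambda_i\bar\omega_i\rho_i(B)=\sum_i\lambda_i\int_B q\,d\rho_i(q)$ for all Borel $B$. Then a quality $i_t\sim\lambda$, a posterior mean $q_t\sim\rho_{i_t,t}$ and an independent type $\theta_t\sim F$ are drawn, and the buyer purchases ($a_t=1$) iff $v(\theta_t,q_t)\ge p_t$. The seller observes $i_t$, $q_t$ and $a_t$. Put $\mathrm{Rev}(p,\rho)=p\sum_i\lambda_i\int\Pr_\theta[v(\theta,q)\ge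 p]\,d\rho_i(q)$. For a signaling scheme $\phi=(\phi_i)_{i\le m}$ (probability laws on a measurable signal space $\Sigma$), let $\mathrm{Rev}(p,\phi)$ be the expected revenue when the buyer purchases iff the expected valuation under the Bayesian posterior given the signal is at least $p$. The expected regret is $$\mathrm{Regret}(T)=T\sup_{p\in[0,U],\,\phi}\mathrm{Rev}(p,\phi)-\sum_{t=1}^T\mathbb E[\mathrm{Rev}(p_t,\rho_t)].$$ **Algorithm.** Let $\kappa(p,q)=\min\{\theta\in[0,1]:v(\theta,q)\ge p\}$, and $\kappa(p,q)=1$ if there is no such $\theta$. Given $\varepsilon>0$, let $\mathcal P=\{\varepsilon,2\varepsilon,\dots\}\cap[0,U]\cup\{U\}$, $\mathcal S=(\{0,\varepsilon,2\varepsilon,\dots\}\cap[0,1])\cup\{1\}\cup\{\kappa(p,\bar\omega_i):p\in\mathcal P,\,i\le m\}$ and $\mathcal Q_p=\{q:\kappa(p,q)\in\mathcal S\}$. In the first $|\mathcal S|$ rounds (truncated at $T$) the seller gives no information and, for each $x\in\mathcal S$ once, posts a price $p\in[0,U]$ with $\kappa(p,\mathbb E_\lambda\omega)=x$. In each later round $t$,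 let $N_t(x)$ be the number of earlier rounds $\tau$ with $\kappa(p_\tau,q_\tau)=x$, let $\bar D_t(x)$ be the average of $a_\tau$ over these rounds, and let $$D^{\mathrm{UCB}}_t(x)=\min\Big\{1,\min_{x'\in\mathcal S,\,x'\le x}\Big(\bar D_t(x')+\sqrt{\tfrac{16\log T}{N_t(x')}}+\tfrac{\sqrt{(1+N_t(x'))\ln(1+N_t(x'))}}{N_t(x')}\Big)\Big\}.$$ The seller plays a maximizer $(p_t,\rho_t)$ of $p\sum_i\lambda_i\int D^{\mathrm{UCB}}_t(\kappa(p,q))\,d\rho_i(q)$ over $p\in\mathcal P$ and Bayes-consistent $\rho$ with every $\rho_i$ supported in $\mathcal Q_p$, with ties broken arbitrarily. **Theorem 1.** For all $U>0$ and $0<c_1\le c_2$ there is a constant $C$, depending on $U,c_1,c_2$ only, such that for all $m\ge1$, $T\ge2$, all markets as above (any qualities, prior, valuation and type CDF), all signal spaces $\Sigma$, and all $\varepsilon$ with $c_1(m\log T/T)^{1/3}\le\varepsilon\le c_2(m\log T/T)^{1/3}$, every run of the algorithm with parameter $\varepsilon$ satisfies $$\mathrm{Regret}(T)\le C\,T^{2/3}(m\log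 T)^{1/3}.$$ -/

import Mathlib

open MeasureTheory

namespace PricingAds

noncomputable section

/-- The primitives of the market: `m` product qualities in `[0,1]`, listed increasingly, a public
prior on them, a distribution of buyer types on `[0,1]`, and a valuation `v θ q`.  A type
distribution is given by its law; laws on `[0,1]` correspond to CDFs. -/
structure Market (m : ℕ) where
  /-- the valuation `v θ q` of a buyer of type `θ` for quality `q` -/
  v : unitInterval → unitInterval → ℝ
  /-- the quality levels -/
  quality : Fin m → unitInterval
  quality_strictMono : StrictMono quality
  /-- the prior probability of each quality level -/
  prior : Fin m → ℝ
  prior_nonneg : ∀ i, 0 ≤ prior i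
  prior_sum : ∑ i, prior i = 1
  /-- the law of the buyer's type -/
  typeLaw : Measure unitInterval
  typeLaw_prob : IsProbabilityMeasure typeLaw

variable {m : ℕ}

/-! ### The valuation -/

/-- Linearity of the valuation in the quality: `v θ q = a θ + b θ * q`. -/
def Market.LinearInQuality (M : Market m) : Prop :=
  ∀ θ, ∃ a b : ℝ, ∀ q : unitInterval, M.v θ q = a + b * (q : ℝ)

/-- Monotonicity in the quality, strict monotonicity in the type, and the `1`-Lipschitz property
in the type. -/
structure Market.RegularValuation (M : Market m) : Prop where
  monotone_quality : ∀ θ, Monotone (M.v θ)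
  strictMono_type : ∀ q, StrictMono fun θ => M.v θ q
  lipschitz_type : ∀ q, LipschitzWith 1 fun θ => M.v θ q

/-! ### Signaling schemes and the benchmark -/

/-- A signaling scheme with signals in `Sig`: a conditional law of the signal for each quality. -/
def IsScheme {Sig : Type*} [MeasurableSpace Sig] (φ : Fin m → Measure Sig) : Prop :=
  ∀ i, IsProbabilityMeasure (φ i)

/-- The Bayesian posterior probability of quality level `j` given the signal `s`, that is, the
density of `λ_j φ_j` with respect to the law `∑ λ_i φ_i` of the signal. -/
def Market.posterior (M : Market m) {Sig : Type*} [MeasurableSpace Sig]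
    (φ : Fin m → Measure Sig) (j : Fin m) (s : Sig) : ℝ :=
  ((ENNReal.ofReal (M.prior j) • φ j).rnDeriv
    (∑ i, ENNReal.ofReal (M.prior i) • φ i) s).toReal

/-- Expected revenue per round of price `p` and signaling scheme `φ`: a buyer of type `θ` who sees
signal `s` purchases iff the posterior expected valuation is at least `p`. -/
def Market.schemeRevenue (M : Market m) {Sig : Type*} [MeasurableSpace Sig]
    (p : ℝ) (φ : Fin m → Measure Sig) : ℝ :=
  p * ∑ i, M.prior i *
    ∫ s, M.typeLaw.real {θ | p ≤ ∑ j, M.posterior φ j s * M.v θ (M.quality j)} ∂(φ i)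

/-- The best expected revenue per round over prices in `[0,U]` and signaling schemes with signals
in `Sig`. -/
def Market.bestRevenue (M : Market m) (U : ℝ) (Sig : Type*) [MeasurableSpace Sig] : ℝ :=
  sSup {r | ∃ p ∈ Set.Icc 0 U, ∃ φ : Fin m → Measure Sig, IsScheme φ ∧ r = M.schemeRevenue p φ}

/-! ### Advertising strategies as distributions of posterior means -/

/-- A feasible advertising strategy: for each quality level `i` a law `ρ i` of the posterior mean,
Bayes-consistent in the sense that the conditional expectation of the quality given the announced
mean `q` is `q`. -/
def Market.IsFeasible (M : Market m) (ρ : Fin m → Measure unitInterval) : Prop :=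
  (∀ i, IsProbabilityMeasure (ρ i)) ∧
  ∀ B : Set unitInterval, MeasurableSet B →
    ∑ i, M.prior i * (M.quality i : ℝ) * (ρ i).real B =
      ∑ i, M.prior i * ∫ q in B, (q : ℝ) ∂(ρ i)

/-- Expected revenue per round of price `p` and advertising strategy `ρ`: a buyer of type `θ` who
is told the posterior mean `q` purchases iff `p ≤ v θ q`. -/
def Market.revenue (M : Market m) (p : ℝ) (ρ : Fin m → Measure unitInterval) : ℝ :=
  p * ∑ i, M.prior i * ∫ q, M.typeLaw.real {θ | p ≤ M.v θ q} ∂(ρ i)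

/-- The prior mean of the quality (it lies in `[0,1]`, so the projection does nothing). -/
def Market.priorMean (M : Market m) : unitInterval :=
  Set.projIcc 0 1 zero_le_one (∑ i, M.prior i * (M.quality i : ℝ))

/-- The critical type: the least type whose valuation of `q` is at least `p`, and `1` if there is
no such type. -/
def Market.criticalType (M : Market m) (p : ℝ) (q : unitInterval) : unitInterval :=
  sInf (insert 1 {θ | p ≤ M.v θ q})

/-! ### The interaction -/

/-- An interaction between the seller and the buyers over the rounds `t = 0, …, T - 1`, on a
probability space with measure `P`.  The σ-algebra `ℱ t` contains the events observed before round
`t`; the price and the advertising strategy of round `t` depend on them only.  Given the past, the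
quality is drawn from the prior, the posterior mean from the strategy at that quality, and the
type, independently, from the type law. -/
structure Interaction (M : Market m) (U : ℝ) (T : ℕ) {Ω : Type*} [mΩ : MeasurableSpace Ω]
    (P : Measure Ω) where
  ℱ : Filtration ℕ mΩ
  price : ℕ → Ω → ℝ
  adv : ℕ → Ω → Fin m → Measure unitInterval
  qual : ℕ → Ω → Fin m
  post : ℕ → Ω → unitInterval
  type : ℕ → Ω → unitInterval
  price_mem : ∀ t < T, ∀ ω, price t ω ∈ Set.Icc 0 U
  adv_feasible : ∀ t < T, ∀ ω, M.IsFeasible (adv t ω)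
  price_measurable : ∀ t < T, Measurable[ℱ t] (price t)
  adv_measurable : ∀ t < T, Measurable[ℱ t] (adv t)
  qual_measurable : ∀ t < T, Measurable[ℱ (t + 1)] (qual t)
  post_measurable : ∀ t < T, Measurable[ℱ (t + 1)] (post t)
  type_measurable : ∀ t < T, Measurable (type t)
  /-- the purchase decision of round `t` is observed -/
  purchase_measurable : ∀ t < T,
    MeasurableSet[ℱ (t + 1)] {ω | price t ω ≤ M.v (type t ω) (post t ω)}
  /-- the conditional law, given the past, of what happens in round `t` -/
  law : ∀ t < T, ∀ B : Set Ω, MeasurableSet[ℱ t] B → ∀ (i : Fin m) (A C : Set unitInterval),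
    MeasurableSet A → MeasurableSet C →
    P.real (B ∩ {ω | qual t ω = i ∧ post t ω ∈ A ∧ type t ω ∈ C}) =
      (∫ ω in B, M.prior i * (adv t ω i).real A ∂P) * M.typeLaw.real C

section

variable {M : Market m} {U : ℝ} {T : ℕ} {Ω : Type*} [mΩ : MeasurableSpace Ω] {P : Measure Ω}

open Classical in
/-- The purchase decision `a_t ∈ {0,1}`. -/
def Interaction.purchase (G : Interaction M U T P) (t : ℕ) (ω : Ω) : ℝ :=
  if G.price t ω ≤ M.v (G.type t ω) (G.post t ω) then 1 else 0

/-- The expected regret over `T` rounds against the best fixed price and signaling scheme with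
signals in `Sig`. -/
def Interaction.regret (G : Interaction M U T P) (Sig : Type*) [MeasurableSpace Sig] : ℝ :=
  T * M.bestRevenue U Sig - ∑ t ∈ Finset.range T, ∫ ω, M.revenue (G.price t ω) (G.adv t ω) ∂P

end

/-! ### The algorithm -/

/-- The price grid `{ε, 2ε, …, U}`. -/
def priceGrid (U ε : ℝ) : Finset ℝ :=
  insert U ((Finset.Icc 1 ⌊U / ε⌋₊).image fun k : ℕ => (k : ℝ) * ε)

open Classical in
/-- The discretized type space: the grid `{0, ε, 2ε, …, 1}` together with the critical types of all
pairs of a grid price and a quality level. -/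
def Market.typeGrid (M : Market m) (U ε : ℝ) : Finset unitInterval :=
  insert 1 ((Finset.range (⌊1 / ε⌋₊ + 1)).image fun k : ℕ =>
      Set.projIcc (0 : ℝ) 1 zero_le_one ((k : ℝ) * ε)) ∪
    (priceGrid U ε ×ˢ Finset.univ).image fun pi : ℝ × Fin m =>
      M.criticalType pi.1 (M.quality pi.2)

/-- The posterior means allowed at price `p`. -/
def Market.allowedMeans (M : Market m) (U ε p : ℝ) : Set unitInterval :=
  {q | M.criticalType p q ∈ M.typeGrid U ε}

/-- The pairs `(p, ρ)` over which the algorithm optimizes. -/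
def Market.IsCandidate (M : Market m) (U ε p : ℝ) (ρ : Fin m → Measure unitInterval) : Prop :=
  p ∈ priceGrid U ε ∧ M.IsFeasible ρ ∧ ∀ i, ρ i (M.allowedMeans U ε p)ᶜ = 0

section

variable {M : Market m} {U : ℝ} {T : ℕ} {Ω : Type*} [mΩ : MeasurableSpace Ω] {P : Measure Ω}

open Classical in
/-- The rounds before `t` in which the realized critical type was exactly `x`. -/
def Interaction.visits (G : Interaction M U T P) (t : ℕ) (ω : Ω) (x : unitInterval) : Finset ℕ :=
  (Finset.range t).filter fun τ => M.criticalType (G.price τ ω) (G.post τ ω) = x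

/-- The number `N_t(x)` of these rounds. -/
def Interaction.count (G : Interaction M U T P) (t : ℕ) (ω : Ω) (x : unitInterval) : ℝ :=
  ((G.visits t ω x).card : ℝ)

/-- The empirical demand at `x`. -/
def Interaction.empDemand (G : Interaction M U T P) (t : ℕ) (ω : Ω) (x : unitInterval) : ℝ :=
  (∑ τ ∈ G.visits t ω x, G.purchase τ ω) / G.count t ω x

/-- The upper confidence bound on the demand: the minimum of `1` and of the single-point indices
at all grid types `x' ≤ x`. -/
def Interaction.ucbDemand (G : Interaction M U T P) (ε : ℝ) (t : ℕ) (ω : Ω)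
    (x : unitInterval) : ℝ :=
  ((M.typeGrid U ε).filter fun x' => x' ≤ x).fold min 1 fun x' =>
    G.empDemand t ω x' + √(16 * Real.log T / G.count t ω x') +
      √((1 + G.count t ω x') * Real.log (1 + G.count t ω x')) / G.count t ω x'

/-- The upper confidence estimate of the revenue. -/
def Interaction.ucbRevenue (G : Interaction M U T P) (ε : ℝ) (t : ℕ) (ω : Ω)
    (p : ℝ) (ρ : Fin m → Measure unitInterval) : ℝ :=
  p * ∑ i, M.prior i * ∫ q, G.ucbDemand ε t ω (M.criticalType p q) ∂(ρ i)

/-- The seller's choices are those of the algorithm with discretization parameter `ε`.  The first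
rounds, one per element of the type grid, offer no information (the posterior mean is the prior
mean) at prices whose critical types at the prior mean run through the type grid, in any order; if
the horizon is shorter than that, only the rounds before it are played.  In every later round, the
price and the strategy maximize the upper confidence estimate of the revenue; ties are broken
arbitrarily. -/
structure Interaction.FollowsAlgorithm (G : Interaction M U T P) (ε : ℝ) : Prop where
  init_grid : ∀ ω, ∀ t < T, t < (M.typeGrid U ε).card →
    M.criticalType (G.price t ω) M.priorMean ∈ M.typeGrid U ε
  init_distinct : ∀ ω, Set.InjOn (fun t => M.criticalType (G.price t ω) M.priorMean)
    {t | t < T ∧ t < (M.typeGrid U ε).card}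
  init_noInfo : ∀ ω, ∀ t < T, t < (M.typeGrid U ε).card → ∀ i,
    G.adv t ω i = Measure.dirac M.priorMean
  candidate : ∀ ω, ∀ t < T, (M.typeGrid U ε).card ≤ t →
    M.IsCandidate U ε (G.price t ω) (G.adv t ω)
  optimal : ∀ ω, ∀ t < T, (M.typeGrid U ε).card ≤ t → ∀ p ρ, M.IsCandidate U ε p ρ →
    G.ucbRevenue ε t ω p ρ ≤ G.ucbRevenue ε t ω (G.price t ω) (G.adv t ω)

end

end

end PricingAds

/-! ### Critical types, grids and rounding of posterior means -/

namespace PricingAds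

noncomputable section

variable {m : ℕ} {M : Market m}

/-! ### Valuations and critical types -/

/-! A purchase depends on the price and the announced mean only through the critical type: type `1`
has probability zero, so almost surely the buyer purchases iff the type is at least `criticalType p
q`. The problem becomes a bandit with one unknown antitone function, `M.demand`, and rounds with
different prices and strategies share data whenever they reach the same grid type. Let `K` be the
size of the type grid.

Discretization (`Market.exists_candidate`). Linearity in the quality lets a scheme be described by
its posterior means. The price is lowered to a grid price, by between `ε` and `2 ε`, and each mean
`q` is rounded down to the largest allowed mean. Bayes consistency is kept as follows: qualities at
most `q` stay in the pool, and those above `q` stay with a common probability that gives the pool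
the right mean, and are revealed otherwise. No buyer is lost: by the Lipschitz property a price cut
of `ε` is a slack of `ε` in the type, which pays for rounding to the next grid type, and revealed
qualities exceed `q`. The loss is at most `2 ε`, without any continuity of the demand.

Concentration and optimism. Given the past and the announced mean, the type still has its original
law, so Hoeffding's lemma gives an exponential supermartingale at every grid type. Markov's
inequality and a union bound give `Concentrated` up to probability `K / T` in each round after the
initial ones (`measure_not_concentrated_le`). On that event the index dominates the demand
everywhere and exceeds it on the grid by at most twice the bonus, so the maximizer loses at most `2
ε` plus `2 U` times the bonus averaged over the critical types that it may reach.

Summation. In expectation that average equals the bonus at the critical type actually reached. Along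
a path the bonuses at one grid type telescope to order `√(log T)` times the root of its visit count,
and Cauchy–Schwarz over the grid gives `√(K T log T)`. Initial rounds and failures cost at most `2 U
K`. Since `K` is of order at most `m / ε`, the prescribed `ε` balances `ε T` against `√(K T log T)`,
and `K` is of no larger order. -/

theorem Market.RegularValuation.continuous_type (hR : M.RegularValuation) (q : unitInterval) :
    Continuous fun θ => M.v θ q :=
  (hR.lipschitz_type q).continuous

theorem Market.LinearInQuality.continuous_quality (hL : M.LinearInQuality) (θ : unitInterval) :
    Continuous (M.v θ) := by
  obtain ⟨a, b, h⟩ := hL θ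
  rw [funext h]
  fun_prop

theorem Market.RegularValuation.sub_le (hR : M.RegularValuation) (q : unitInterval)
    {x y : unitInterval} (h : y ≤ x) : M.v x q - M.v y q ≤ (x : ℝ) - y := by
  have h1 := (hR.lipschitz_type q).dist_le_mul x y
  have h2 : (y : ℝ) ≤ x := h
  rw [Real.dist_eq, Subtype.dist_eq, Real.dist_eq, abs_of_nonneg (sub_nonneg.2 h2)] at h1
  simpa using (le_abs_self _).trans h1

/-- The valuation is continuous in the type, so the infimum is attained. The alternative `θ = 1`
comes from the default value of the critical type; it disappears once type `1` is a null set. -/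
theorem Market.RegularValuation.criticalType_le_iff (hR : M.RegularValuation) {p : ℝ}
    {q θ : unitInterval} : M.criticalType p q ≤ θ ↔ θ = 1 ∨ p ≤ M.v θ q := by
  constructor
  · intro h
    have hc : IsClosed (insert 1 {θ | p ≤ M.v θ q} : Set unitInterval) :=
      isClosed_singleton.union (isClosed_le continuous_const (hR.continuous_type q))
    have hmem : M.criticalType p q ∈ (insert 1 {θ | p ≤ M.v θ q} : Set unitInterval) :=
      hc.sInf_mem (Set.insert_nonempty _ _)
    rcases hmem with h1 | h1
    · left
      exact le_antisymm unitInterval.le_one' (h1 ▸ h)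
    · right
      exact le_trans h1 ((hR.strictMono_type q).monotone h)
  · rintro (rfl | h)
    · exact unitInterval.le_one'
    · exact sInf_le (Set.mem_insert_of_mem _ h)

/-- By the Lipschitz property, moving down from `x` by the surplus `M.v x q - p`, truncated at type
`0`, leaves a type that still buys. The strict version is what makes the critical type upper
semicontinuous. -/
theorem Market.RegularValuation.criticalType_lt_iff (hR : M.RegularValuation) {p : ℝ}
    {q x : unitInterval} : M.criticalType p q < x ↔ 0 < x ∧ p < M.v x q := by
  constructor
  · intro h
    refine ⟨lt_of_le_of_lt unitInterval.nonneg' h, ?_⟩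
    rcases hR.criticalType_le_iff.1 (le_refl (M.criticalType p q)) with h1 | h1
    · exact absurd (h1 ▸ h) (not_lt.2 unitInterval.le_one')
    · exact lt_of_le_of_lt h1 (hR.strictMono_type q h)
  · rintro ⟨h0, h⟩
    set y : unitInterval := Set.projIcc 0 1 zero_le_one ((x : ℝ) - (M.v x q - p)) with hy
    have hx1 := x.2.2
    have hx0 : (0 : ℝ) < x := h0
    have hyv : (y : ℝ) = max 0 ((x : ℝ) - (M.v x q - p)) := by
      rw [hy, Set.coe_projIcc, min_eq_right]
      linarith
    have hyx : y < x := by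
      change (y : ℝ) < x
      rw [hyv, max_lt_iff]
      exact ⟨hx0, by linarith⟩
    refine lt_of_le_of_lt (hR.criticalType_le_iff.2 (Or.inr ?_)) hyx
    have := hR.sub_le q hyx.le
    have h2 := le_max_right 0 ((x : ℝ) - (M.v x q - p))
    linarith

theorem Market.RegularValuation.continuous_criticalType (hR : M.RegularValuation)
    (hL : M.LinearInQuality) :
    Continuous fun z : ℝ × unitInterval => M.criticalType z.1 z.2 := by
  rw [continuous_iff_lower_upperSemicontinuous, lowerSemicontinuous_iff_isOpen_preimage,
    upperSemicontinuous_iff_isOpen_preimage]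
  constructor <;> intro x
  · have : (fun z : ℝ × unitInterval => M.criticalType z.1 z.2) ⁻¹' Set.Ioi x =
        {z | ¬ (x = 1 ∨ z.1 ≤ M.v x z.2)} := by
      ext z
      simp [← hR.criticalType_le_iff]
    rw [this]
    by_cases hx : x = 1
    · simp [hx]
    · simp only [hx, false_or, not_le]
      exact isOpen_lt ((hL.continuous_quality x).comp continuous_snd) continuous_fst
  · have : (fun z : ℝ × unitInterval => M.criticalType z.1 z.2) ⁻¹' Set.Iio x =
        {z | 0 < x ∧ z.1 < M.v x z.2} := by
      ext z
      simp [← hR.criticalType_lt_iff]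
    rw [this]
    by_cases hx : 0 < x
    · simp only [hx, true_and]
      exact isOpen_lt continuous_fst ((hL.continuous_quality x).comp continuous_snd)
    · simp [hx]

theorem Market.RegularValuation.continuous_criticalType_right (hR : M.RegularValuation)
    (hL : M.LinearInQuality) (p : ℝ) : Continuous (M.criticalType p) :=
  (hR.continuous_criticalType hL).comp (by fun_prop : Continuous fun q : unitInterval => (p, q))

theorem Market.RegularValuation.antitone_criticalType (hR : M.RegularValuation) (p : ℝ) :
    Antitone (M.criticalType p) := by
  intro q q' h
  rw [hR.criticalType_le_iff]
  exact (hR.criticalType_le_iff.1 (le_refl (M.criticalType p q))).imp_right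
    fun h1 => h1.trans (hR.monotone_quality _ h)

/-- The demand `Pr[θ ≥ x]` at the critical type `x`. -/
def Market.demand (M : Market m) (x : unitInterval) : ℝ := M.typeLaw.real (Set.Ici x)

theorem Market.demand_nonneg (x : unitInterval) : 0 ≤ M.demand x := measureReal_nonneg

theorem Market.demand_le_one (x : unitInterval) : M.demand x ≤ 1 :=
  haveI := M.typeLaw_prob
  measureReal_le_one

theorem Market.antitone_demand : Antitone M.demand := fun _ _ h =>
  haveI := M.typeLaw_prob
  measureReal_mono (Set.Ici_subset_Ici.2 h)

/-- The two events can differ only at type `1`, which carries no mass. -/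
theorem Market.RegularValuation.typeLaw_purchase (hR : M.RegularValuation)
    (h1 : M.typeLaw {1} = 0) (p : ℝ) (q : unitInterval) :
    M.typeLaw.real {θ | p ≤ M.v θ q} = M.demand (M.criticalType p q) := by
  refine measureReal_congr ?_
  filter_upwards [compl_mem_ae_iff.2 h1] with θ hθ
  refine propext ?_
  change p ≤ M.v θ q ↔ M.criticalType p q ≤ θ
  rw [hR.criticalType_le_iff]
  exact ⟨Or.inr, fun h => h.resolve_left hθ⟩

theorem Market.RegularValuation.revenue_eq (hR : M.RegularValuation)
    (h1 : M.typeLaw {1} = 0) (p : ℝ) (ρ : Fin m → Measure unitInterval) :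
    M.revenue p ρ = p * ∑ i, M.prior i * ∫ q, M.demand (M.criticalType p q) ∂(ρ i) := by
  simp only [Market.revenue, hR.typeLaw_purchase h1]

/-! ### Grids -/

theorem zero_mem_typeGrid (U ε : ℝ) : 0 ∈ M.typeGrid U ε := by
  classical
  simp only [Market.typeGrid, Finset.mem_union, Finset.mem_insert, Finset.mem_image,
    Finset.mem_range]
  refine Or.inl (Or.inr ⟨0, by omega, ?_⟩)
  simp

theorem one_mem_typeGrid (U ε : ℝ) : 1 ∈ M.typeGrid U ε := by
  classical
  simp [Market.typeGrid]

theorem criticalType_quality_mem_typeGrid {U ε p : ℝ} (hp : p ∈ priceGrid U ε) (i : Fin m) :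
    M.criticalType p (M.quality i) ∈ M.typeGrid U ε := by
  classical
  simp only [Market.typeGrid, Finset.mem_union, Finset.mem_image]
  exact Or.inr ⟨(p, i), by simp [hp], rfl⟩

theorem exists_typeGrid_mem_Icc {U ε : ℝ} (hε : 0 < ε) (y : unitInterval) :
    ∃ x ∈ M.typeGrid U ε, y ≤ x ∧ (x : ℝ) ≤ y + ε := by
  classical
  by_cases h : (⌈(y : ℝ) / ε⌉₊ : ℝ) * ε ≤ 1
  · have h0 : (0 : ℝ) ≤ (⌈(y : ℝ) / ε⌉₊ : ℝ) * ε := by positivity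
    refine ⟨Set.projIcc 0 1 zero_le_one ((⌈(y : ℝ) / ε⌉₊ : ℝ) * ε), ?_, ?_, ?_⟩
    · simp only [Market.typeGrid, Finset.mem_union, Finset.mem_insert, Finset.mem_image,
        Finset.mem_range]
      refine Or.inl (Or.inr ⟨_, ?_, rfl⟩)
      exact Nat.lt_succ_of_le (Nat.le_floor ((le_div_iff₀ hε).2 h))
    · change (y : ℝ) ≤ _
      rw [Set.coe_projIcc, min_eq_right h, max_eq_right h0]
      exact (div_le_iff₀ hε).1 (Nat.le_ceil _)
    · rw [Set.coe_projIcc, min_eq_right h, max_eq_right h0]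
      have := Nat.ceil_lt_add_one (div_nonneg y.2.1 hε.le)
      have h3 : (⌈(y : ℝ) / ε⌉₊ : ℝ) * ε < ((y : ℝ) / ε + 1) * ε :=
        mul_lt_mul_of_pos_right this hε
      rw [add_mul, div_mul_cancel₀ _ hε.ne'] at h3
      linarith
  · refine ⟨1, one_mem_typeGrid U ε, unitInterval.le_one', ?_⟩
    have := Nat.ceil_lt_add_one (div_nonneg y.2.1 hε.le)
    have h3 : (⌈(y : ℝ) / ε⌉₊ : ℝ) * ε < ((y : ℝ) / ε + 1) * ε :=
      mul_lt_mul_of_pos_right this hε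
    rw [add_mul, div_mul_cancel₀ _ hε.ne'] at h3
    push Not at h
    simp only [Set.Icc.coe_one]
    linarith

theorem card_priceGrid_le (U ε : ℝ) : (priceGrid U ε).card ≤ ⌊U / ε⌋₊ + 1 := by
  classical
  refine (Finset.card_insert_le _ _).trans (Nat.add_le_add_right ?_ 1)
  exact Finset.card_image_le.trans (by simp)

theorem card_typeGrid_le (M : Market m) (U ε : ℝ) :
    (M.typeGrid U ε).card ≤ ⌊1 / ε⌋₊ + 2 + (⌊U / ε⌋₊ + 1) * m := by
  classical
  refine (Finset.card_union_le _ _).trans (Nat.add_le_add ?_ ?_)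
  · refine (Finset.card_insert_le _ _).trans (Nat.add_le_add_right ?_ 1)
    exact Finset.card_image_le.trans (by simp)
  · refine Finset.card_image_le.trans ?_
    rw [Finset.card_product, Finset.card_univ, Fintype.card_fin]
    exact Nat.mul_le_mul_right _ (card_priceGrid_le U ε)

/-! ### Rounding a posterior mean down to an allowed one -/

/-- The largest allowed posterior mean that is at most `q`. -/
def Market.roundDown (M : Market m) (U ε p : ℝ) (q : unitInterval) : unitInterval :=
  sSup (M.allowedMeans U ε p ∩ Set.Iic q)

theorem Market.monotone_roundDown (U ε p : ℝ) : Monotone (M.roundDown U ε p) := fun _ _ h =>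
  sSup_le_sSup (Set.inter_subset_inter_right _ (Set.Iic_subset_Iic.2 h))

theorem Market.roundDown_le (U ε p : ℝ) (q : unitInterval) : M.roundDown U ε p q ≤ q :=
  sSup_le fun _ h => h.2

theorem Market.le_roundDown {U ε p : ℝ} {q q' : unitInterval} (h : q' ∈ M.allowedMeans U ε p)
    (hq : q' ≤ q) : q' ≤ M.roundDown U ε p q :=
  le_sSup ⟨h, hq⟩

/-- Closedness makes the supremum defining `roundDown` an allowed mean as soon as some allowed mean
lies below `q`. -/
theorem Market.isClosed_allowedMeans (hR : M.RegularValuation) (hL : M.LinearInQuality)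
    (U ε p : ℝ) : IsClosed (M.allowedMeans U ε p) :=
  ((M.typeGrid U ε).finite_toSet.isClosed).preimage (hR.continuous_criticalType_right hL p)

theorem Market.roundDown_mem (hR : M.RegularValuation) (hL : M.LinearInQuality)
    {U ε p : ℝ} {q q' : unitInterval} (h : q' ∈ M.allowedMeans U ε p) (hq : q' ≤ q) :
    M.roundDown U ε p q ∈ M.allowedMeans U ε p :=
  (((M.isClosed_allowedMeans hR hL U ε p).inter isClosed_Iic).sSup_mem
    (⟨q', h, hq⟩ : (M.allowedMeans U ε p ∩ Set.Iic q).Nonempty)).1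

theorem Market.quality_mem_allowedMeans {U ε p : ℝ} (hp : p ∈ priceGrid U ε) (i : Fin m) :
    M.quality i ∈ M.allowedMeans U ε p :=
  criticalType_quality_mem_typeGrid hp i

/-- Let `x` be a grid type at most `ε` above the critical type of `q`. By the intermediate value
theorem some mean between `M.quality i` and `q` has critical type exactly `x`, unless the critical
type of `M.quality i` is already at most `x`; but that quality is itself an allowed mean. -/
theorem Market.criticalType_roundDown_le (hR : M.RegularValuation) (hL : M.LinearInQuality)
    {U ε p : ℝ} (hε : 0 < ε) (hp : p ∈ priceGrid U ε) {q : unitInterval} {i : Fin m}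
    (hi : M.quality i ≤ q) :
    (M.criticalType p (M.roundDown U ε p q) : ℝ) ≤ M.criticalType p q + ε := by
  obtain ⟨x, hxS, hx1, hx2⟩ := exists_typeGrid_mem_Icc (M := M) (U := U) hε (M.criticalType p q)
  refine le_trans ?_ hx2
  change M.criticalType p _ ≤ x
  rcases le_total x (M.criticalType p (M.quality i)) with h | h
  · obtain ⟨q', hq', hq'x⟩ := intermediate_value_Icc' hi
      (hR.continuous_criticalType_right hL p).continuousOn ⟨hx1, h⟩
    rw [← hq'x]
    refine hR.antitone_criticalType p (M.le_roundDown ?_ hq'.2)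
    change M.criticalType p q' ∈ M.typeGrid U ε
    rwa [hq'x]
  · exact (hR.antitone_criticalType p
      (M.le_roundDown (M.quality_mem_allowedMeans hp i) hi)).trans h

/-- A type that buys at price `p` given the mean `q` also buys at the price `p' ≤ p - ε` given the
rounded mean. -/
theorem Market.criticalType_roundDown_le_of_purchase (hR : M.RegularValuation)
    (hL : M.LinearInQuality) {U ε p p' : ℝ} (hε : 0 < ε) (hp' : p' ∈ priceGrid U ε)
    (hpp : p' + ε ≤ p) {q θ : unitInterval} {i : Fin m} (hi : M.quality i ≤ q)
    (hθ : p ≤ M.v θ q) : M.criticalType p' (M.roundDown U ε p' q) ≤ θ := by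
  -- If `θ ≥ ε`, type `θ - ε` buys at `p'`, and rounding the mean raises the critical type by at
  -- most `ε`. If `θ ≤ ε`, the price cut makes even type `0` buy, and then `q` needs no rounding
  -- since `0` is a grid type.
  rcases le_total ε (θ : ℝ) with h | h
  · set y : unitInterval := ⟨(θ : ℝ) - ε, by linarith, by linarith [θ.2.2]⟩ with hy
    have hyθ : y ≤ θ := by
      change (θ : ℝ) - ε ≤ θ
      linarith
    have h1 := hR.sub_le q hyθ
    have h2 : M.criticalType p' q ≤ y := by
      refine hR.criticalType_le_iff.2 (Or.inr ?_)
      have : (y : ℝ) = θ - ε := rfl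
      linarith
    have h3 := M.criticalType_roundDown_le hR hL hε hp' hi
    have h4 : (M.criticalType p' q : ℝ) ≤ θ - ε := h2
    change (_ : ℝ) ≤ θ
    linarith
  · have h1 := hR.sub_le q (unitInterval.nonneg' : 0 ≤ θ)
    have h2 : M.criticalType p' q ≤ 0 := by
      refine hR.criticalType_le_iff.2 (Or.inr ?_)
      have : ((0 : unitInterval) : ℝ) = 0 := rfl
      linarith
    have h3 : M.criticalType p' q = 0 := le_antisymm h2 unitInterval.nonneg'
    have h4 : q ∈ M.allowedMeans U ε p' := by
      change M.criticalType p' q ∈ M.typeGrid U ε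
      rw [h3]
      exact zero_mem_typeGrid U ε
    exact ((hR.antitone_criticalType p' (M.le_roundDown h4 le_rfl)).trans h2).trans
      unitInterval.nonneg'

end

end PricingAds

/-! ### Partial revelation, posteriors and the discretized benchmark -/

namespace PricingAds

noncomputable section

variable {m : ℕ} {M : Market m}

theorem integrable_of_abs_le {α : Type*} [MeasurableSpace α] {μ : Measure α} [IsFiniteMeasure μ]
    {f : α → ℝ} (hf : Measurable f) {C : ℝ} (hC : ∀ x, |f x| ≤ C) : Integrable f μ :=
  Integrable.of_bound hf.aestronglyMeasurable C (Filter.Eventually.of_forall hC)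

/-! ### Revealing with some probability -/

section Reveal

variable {Sig : Type*} [MeasurableSpace Sig] (φ : Measure Sig)

/-- The law of the announced mean if the signal `s` has law `φ`, and the announcement is `F s` with
probability `r s` and `w` otherwise. -/
def revealLaw (F : Sig → unitInterval) (r : Sig → ℝ) (w : unitInterval) : Measure unitInterval :=
  (φ.withDensity fun s => ENNReal.ofReal (r s)).map F +
    (∫⁻ s, ENNReal.ofReal (1 - r s) ∂φ) • Measure.dirac w

variable {φ} {F : Sig → unitInterval} {r : Sig → ℝ} {w : unitInterval}

theorem isProbabilityMeasure_revealLaw [IsProbabilityMeasure φ] (hF : Measurable F)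
    (hr : Measurable r) (hr0 : ∀ s, 0 ≤ r s) (hr1 : ∀ s, r s ≤ 1) :
    IsProbabilityMeasure (revealLaw φ F r w) := by
  constructor
  rw [revealLaw, Measure.add_apply, Measure.map_apply hF MeasurableSet.univ, Set.preimage_univ,
    withDensity_apply _ MeasurableSet.univ, Measure.smul_apply, measure_univ, smul_eq_mul, mul_one,
    Measure.restrict_univ, ← lintegral_add_left hr.ennreal_ofReal]
  have : ∀ s, ENNReal.ofReal (r s) + ENNReal.ofReal (1 - r s) = 1 := fun s => by
    rw [← ENNReal.ofReal_add (hr0 s) (sub_nonneg.2 (hr1 s))]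
    simp
  simp [this]

theorem integral_revealLaw [IsProbabilityMeasure φ] (hF : Measurable F)
    (hr : Measurable r) (hr0 : ∀ s, 0 ≤ r s) (hr1 : ∀ s, r s ≤ 1) {g : unitInterval → ℝ}
    (hg : Measurable g) {C : ℝ} (hC : ∀ q, |g q| ≤ C) :
    ∫ q, g q ∂(revealLaw φ F r w) = ∫ s, (r s * g (F s) + (1 - r s) * g w) ∂φ := by
  have := isProbabilityMeasure_revealLaw (φ := φ) (w := w) hF hr hr0 hr1
  have hint : Integrable g (revealLaw φ F r w) := integrable_of_abs_le hg hC
  have hrb : ∀ s, |r s| ≤ 1 := fun s => abs_le.2 ⟨by linarith [hr0 s], hr1 s⟩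
  have h1r : Integrable (fun s => 1 - r s) φ :=
    (integrable_const 1).sub (integrable_of_abs_le hr hrb)
  rw [revealLaw] at hint ⊢
  rw [integrable_add_measure] at hint
  rw [integral_add_measure hint.1 hint.2, integral_map hF.aemeasurable hg.aestronglyMeasurable,
    integral_withDensity_eq_integral_toReal_smul hr.ennreal_ofReal (by simp),
    integral_smul_measure, integral_dirac, integral_add, integral_mul_const,
    ← ofReal_integral_eq_lintegral_ofReal h1r (Filter.Eventually.of_forall fun s =>
      sub_nonneg.2 (hr1 s)),
    ENNReal.toReal_ofReal (integral_nonneg fun s => sub_nonneg.2 (hr1 s))]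
  · simp [ENNReal.toReal_ofReal (hr0 _)]
  · refine integrable_of_abs_le (hr.mul (hg.comp hF)) (C := C) fun s => ?_
    rw [abs_mul]
    have h0 : 0 ≤ |g (F s)| := abs_nonneg _
    nlinarith [hrb s, hC (F s), abs_nonneg (r s)]
  · exact h1r.mul_const _

theorem revealLaw_compl_eq_zero {A : Set unitInterval} (hA : MeasurableSet A)
    (hF : Measurable F) (hFA : ∀ s, F s ∈ A) (hw : w ∈ A) : revealLaw φ F r w Aᶜ = 0 := by
  have : F ⁻¹' Aᶜ = ∅ := Set.eq_empty_of_forall_notMem fun s hs => hs (hFA s)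
  rw [revealLaw, Measure.add_apply, Measure.map_apply hF hA.compl, this, Measure.smul_apply,
    Measure.dirac_apply' _ hA.compl]
  simp [hw]

end Reveal

/-! ### Signals and posteriors -/

section Posterior

variable {Sig : Type*} [MeasurableSpace Sig] {φ : Fin m → Measure Sig}

/-- The law of the signal. -/
def Market.signalLaw (M : Market m) (φ : Fin m → Measure Sig) : Measure Sig :=
  ∑ i, ENNReal.ofReal (M.prior i) • φ i

theorem Market.isFiniteMeasure_smul (M : Market m) (hφ : IsScheme φ) (i : Fin m) :
    IsFiniteMeasure (ENNReal.ofReal (M.prior i) • φ i) :=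
  haveI := hφ i
  (φ i).smul_finite ENNReal.ofReal_ne_top

theorem Market.isFiniteMeasure_signalLaw (M : Market m) (hφ : IsScheme φ) :
    IsFiniteMeasure (M.signalLaw φ) := by
  have := M.isFiniteMeasure_smul hφ
  unfold Market.signalLaw
  infer_instance

theorem Market.smul_absolutelyContinuous (M : Market m) (φ : Fin m → Measure Sig) (i : Fin m) :
    ENNReal.ofReal (M.prior i) • φ i ≪ M.signalLaw φ := by
  refine Measure.absolutelyContinuous_of_le (Measure.le_iff.2 fun s _ => ?_)
  rw [Market.signalLaw, Measure.finsetSum_apply]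
  exact Finset.single_le_sum (f := fun i => (ENNReal.ofReal (M.prior i) • φ i) s)
    (fun _ _ => zero_le) (Finset.mem_univ i)

theorem Market.measurable_posterior (M : Market m) (φ : Fin m → Measure Sig) (i : Fin m) :
    Measurable (M.posterior φ i) :=
  (Measure.measurable_rnDeriv _ _).ennreal_toReal

theorem Market.posterior_nonneg (M : Market m) (φ : Fin m → Measure Sig) (i : Fin m) (s : Sig) :
    0 ≤ M.posterior φ i s :=
  ENNReal.toReal_nonneg

/-- Change of measure: the posterior of `i` is the density of the weighted law `φ i` with respect to
the signal law. Sums over qualities can then be treated signal by signal. -/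
theorem Market.sum_prior_mul_integral (hφ : IsScheme φ) {h : Fin m → Sig → ℝ}
    (hh : ∀ i, Integrable (h i) (φ i)) :
    ∑ i, M.prior i * ∫ s, h i s ∂(φ i) =
      ∫ s, ∑ i, M.posterior φ i s * h i s ∂(M.signalLaw φ) := by
  have := M.isFiniteMeasure_smul hφ
  have := M.isFiniteMeasure_signalLaw hφ
  have hi : ∀ i, Integrable (fun s => M.posterior φ i s * h i s) (M.signalLaw φ) := fun i => by
    have := (integrable_rnDeriv_smul_iff (f := h i) (M.smul_absolutelyContinuous φ i)).2
      ((hh i).smul_measure ENNReal.ofReal_ne_top)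
    simp only [smul_eq_mul] at this
    exact this
  rw [integral_finsetSum _ fun i _ => hi i]
  refine Finset.sum_congr rfl fun i _ => ?_
  have h1 := integral_rnDeriv_smul (f := h i) (M.smul_absolutelyContinuous φ i)
  rw [integral_smul_measure, ENNReal.toReal_ofReal (M.prior_nonneg i), smul_eq_mul] at h1
  rw [← h1]
  rfl

theorem Market.integrable_posterior (hφ : IsScheme φ) (i : Fin m) :
    Integrable (M.posterior φ i) (M.signalLaw φ) := by
  have := M.isFiniteMeasure_smul hφ
  have := M.isFiniteMeasure_signalLaw hφ
  exact Measure.integrable_toReal_rnDeriv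

theorem Market.sum_posterior (hφ : IsScheme φ) :
    ∀ᵐ s ∂(M.signalLaw φ), ∑ i, M.posterior φ i s = 1 := by
  have := M.isFiniteMeasure_smul hφ
  have := M.isFiniteMeasure_signalLaw hφ
  refine Integrable.ae_eq_of_forall_setIntegral_eq _ _
    (integrable_finsetSum _ fun i _ => M.integrable_posterior hφ i) (integrable_const 1) ?_
  intro s hs _
  rw [integral_finsetSum _ fun i _ => (M.integrable_posterior hφ i).integrableOn]
  have h1 : ∀ i, ∫ x in s, M.posterior φ i x ∂(M.signalLaw φ) =
      (ENNReal.ofReal (M.prior i) • φ i).real s := fun i =>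
    Measure.setIntegral_toReal_rnDeriv (M.smul_absolutelyContinuous φ i) s
  simp only [h1, setIntegral_const, smul_eq_mul, mul_one]
  rw [Market.signalLaw, measureReal_def, Measure.finsetSum_apply, ENNReal.toReal_sum]
  · rfl
  · exact fun i _ => measure_ne_top _ _

/-- Only laws with positive prior are dominated by the signal law. The others enter every revenue
with weight zero. -/
theorem Market.ae_of_ae_signalLaw {p : Sig → Prop} (h : ∀ᵐ s ∂(M.signalLaw φ), p s) {i : Fin m}
    (hi : M.prior i ≠ 0) : ∀ᵐ s ∂(φ i), p s := by
  have h1 := (M.smul_absolutelyContinuous φ i).ae_le h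
  have h2 : ENNReal.ofReal (M.prior i) ≠ 0 :=
    (ENNReal.ofReal_pos.2 (lt_of_le_of_ne (M.prior_nonneg i) hi.symm)).ne'
  have h3 : (ENNReal.ofReal (M.prior i) • φ i) {s | ¬ p s} = 0 := h1
  rw [Measure.smul_apply, smul_eq_mul, mul_eq_zero] at h3
  exact h3.resolve_left h2

end Posterior

end

end PricingAds

namespace PricingAds

noncomputable section

variable {m : ℕ} {M : Market m}

/-! ### Discretizing the benchmark -/

theorem Market.pos_card (M : Market m) : 0 < m := by
  rcases Nat.eq_zero_or_pos m with rfl | h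
  · simpa using M.prior_sum
  · exact h

/-- The lowest quality level. -/
def Market.lowest (M : Market m) : Fin m := ⟨0, M.pos_card⟩

theorem Market.quality_lowest_le (i : Fin m) : M.quality M.lowest ≤ M.quality i :=
  M.quality_strictMono.monotone (Nat.zero_le i.1)

section

variable {Sig : Type*} [MeasurableSpace Sig]

/-- The posterior mean of the quality, truncated to lie between the lowest quality and `1`. -/
def Market.meanOf (M : Market m) (φ : Fin m → Measure Sig) (s : Sig) : unitInterval :=
  max (M.quality M.lowest)
    (Set.projIcc 0 1 zero_le_one (∑ j, M.posterior φ j s * (M.quality j : ℝ)))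

theorem Market.measurable_meanOf (M : Market m) (φ : Fin m → Measure Sig) :
    Measurable (M.meanOf φ) := by
  refine measurable_const.max (continuous_projIcc.measurable.comp ?_)
  exact Finset.measurable_sum _ fun j _ => (M.measurable_posterior φ j).mul_const _

theorem Market.meanOf_eq {φ : Fin m → Measure Sig} {s : Sig}
    (h : ∑ j, M.posterior φ j s = 1) :
    (M.meanOf φ s : ℝ) = ∑ j, M.posterior φ j s * (M.quality j : ℝ) := by
  have h1 : ∑ j, M.posterior φ j s * (M.quality j : ℝ) ≤ 1 := by
    rw [← h]
    exact Finset.sum_le_sum fun j _ =>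
      mul_le_of_le_one_right (M.posterior_nonneg φ j s) (M.quality j).2.2
  have h2 : (M.quality M.lowest : ℝ) ≤ ∑ j, M.posterior φ j s * (M.quality j : ℝ) := by
    calc (M.quality M.lowest : ℝ) = ∑ j, M.posterior φ j s * (M.quality M.lowest : ℝ) := by
          rw [← Finset.sum_mul, h, one_mul]
      _ ≤ _ := Finset.sum_le_sum fun j _ =>
          mul_le_mul_of_nonneg_left (M.quality_lowest_le j) (M.posterior_nonneg φ j s)
  have h0 : (0 : ℝ) ≤ ∑ j, M.posterior φ j s * (M.quality j : ℝ) :=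
    Finset.sum_nonneg fun j _ => mul_nonneg (M.posterior_nonneg φ j s) (M.quality j).2.1
  have h3 : (M.meanOf φ s : ℝ) = max (M.quality M.lowest : ℝ)
      (Set.projIcc (0 : ℝ) 1 zero_le_one (∑ j, M.posterior φ j s * (M.quality j : ℝ))) :=
    (Subtype.mono_coe _).map_max
  rw [h3, Set.projIcc_of_mem zero_le_one ⟨h0, h1⟩]
  exact max_eq_right h2

/-- Affine functions commute with averages whose weights sum to one. Hence a signal matters only
through its posterior mean. -/
theorem Market.expected_valuation_eq (hL : M.LinearInQuality) {φ : Fin m → Measure Sig} {s : Sig}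
    (h : ∑ j, M.posterior φ j s = 1) (θ : unitInterval) :
    ∑ j, M.posterior φ j s * M.v θ (M.quality j) = M.v θ (M.meanOf φ s) := by
  obtain ⟨a, b, hab⟩ := hL θ
  simp only [hab, M.meanOf_eq h, mul_add, Finset.sum_add_distrib, ← Finset.sum_mul, h, one_mul,
    Finset.mul_sum]
  congr 1
  exact Finset.sum_congr rfl fun j _ => by ring

/-- Revenue of a scheme in terms of the posterior mean. -/
theorem Market.schemeRevenue_eq (hR : M.RegularValuation) (hL : M.LinearInQuality)
    (h1 : M.typeLaw {1} = 0) {φ : Fin m → Measure Sig} (hφ : IsScheme φ) (p : ℝ) :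
    M.schemeRevenue p φ = p * ∑ i, M.prior i *
      ∫ s, M.demand (M.criticalType p (M.meanOf φ s)) ∂(φ i) := by
  unfold Market.schemeRevenue
  congr 1
  refine Finset.sum_congr rfl fun i _ => ?_
  rcases eq_or_ne (M.prior i) 0 with h0 | h0
  · simp [h0]
  congr 1
  refine integral_congr_ae ?_
  filter_upwards [M.ae_of_ae_signalLaw (M.sum_posterior hφ) h0] with s hs
  simp only [M.expected_valuation_eq hL hs, hR.typeLaw_purchase h1]

/-- The probability that a quality above the mean joins the pool that lowers the mean to `f`. -/
def Market.poolProb (M : Market m) (φ : Fin m → Measure Sig) (f : unitInterval → unitInterval)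
    (s : Sig) : ℝ :=
  min 1 ((∑ j, if M.quality j ≤ M.meanOf φ s then
      M.posterior φ j s * max 0 ((f (M.meanOf φ s) : ℝ) - M.quality j) else 0) /
    ∑ j, if M.quality j ≤ M.meanOf φ s then 0 else
      M.posterior φ j s * ((M.quality j : ℝ) - f (M.meanOf φ s)))

/-- The probability that quality `i` joins the pool. -/
def Market.pool (M : Market m) (φ : Fin m → Measure Sig) (f : unitInterval → unitInterval)
    (i : Fin m) (s : Sig) : ℝ :=
  if M.quality i ≤ M.meanOf φ s then 1 else M.poolProb φ f s

variable {φ : Fin m → Measure Sig} {f : unitInterval → unitInterval}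

theorem Market.measurable_pool (hf : Measurable f) (i : Fin m) :
    Measurable (M.pool φ f i) := by
  have hm := M.measurable_meanOf φ
  have hfm : Measurable fun s => (f (M.meanOf φ s) : ℝ) :=
    measurable_subtype_coe.comp (hf.comp hm)
  have hset : ∀ j, MeasurableSet {s | M.quality j ≤ M.meanOf φ s} := fun j =>
    measurableSet_le measurable_const hm
  refine Measurable.ite (hset i) measurable_const (measurable_const.min (Measurable.div ?_ ?_))
  · refine Finset.measurable_sum _ fun j _ => Measurable.ite (hset j) ?_ measurable_const
    exact (M.measurable_posterior φ j).mul (measurable_const.max (hfm.sub_const _))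
  · refine Finset.measurable_sum _ fun j _ => Measurable.ite (hset j) measurable_const ?_
    exact (M.measurable_posterior φ j).mul (hfm.const_sub _)

theorem Market.poolProb_nonneg (hfle : ∀ q, f q ≤ q) (s : Sig) : 0 ≤ M.poolProb φ f s := by
  refine le_min zero_le_one (div_nonneg ?_ ?_) <;> refine Finset.sum_nonneg fun j _ => ?_
  · split_ifs
    · exact mul_nonneg (M.posterior_nonneg φ j s) (le_max_left _ _)
    · exact le_rfl
  · split_ifs with h
    · exact le_rfl
    · refine mul_nonneg (M.posterior_nonneg φ j s) (sub_nonneg.2 ?_)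
      exact (hfle _).trans (not_le.1 h).le

theorem Market.pool_nonneg (hfle : ∀ q, f q ≤ q) (i : Fin m) (s : Sig) :
    0 ≤ M.pool φ f i s := by
  unfold Market.pool
  split_ifs
  exacts [zero_le_one, M.poolProb_nonneg hfle s]

theorem Market.pool_le_one (i : Fin m) (s : Sig) : M.pool φ f i s ≤ 1 := by
  unfold Market.pool
  split_ifs
  exacts [le_rfl, min_le_left _ _]

/-- The mean of the pool. -/
theorem Market.sum_pool (hfle : ∀ q, f q ≤ q)
    (hfq : ∀ q j, M.quality j ≤ q → M.quality j ≤ f q) {s : Sig}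
    (h : ∑ j, M.posterior φ j s = 1) :
    ∑ i, M.posterior φ i s *
      (M.pool φ f i s * ((M.quality i : ℝ) - f (M.meanOf φ s))) = 0 := by
  set q := M.meanOf φ s with hq
  set N := ∑ j, if M.quality j ≤ q then
      M.posterior φ j s * max 0 ((f q : ℝ) - M.quality j) else 0 with hN
  set D := ∑ j, if M.quality j ≤ q then 0 else
      M.posterior φ j s * ((M.quality j : ℝ) - f q) with hD
  have hN0 : 0 ≤ N := Finset.sum_nonneg fun j _ => by
    split_ifs
    · exact mul_nonneg (M.posterior_nonneg φ j s) (le_max_left _ _)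
    · exact le_rfl
  have hmax : ∀ j, M.quality j ≤ q → max 0 ((f q : ℝ) - M.quality j) = f q - M.quality j :=
    fun j hj => max_eq_right (sub_nonneg.2 (hfq q j hj))
  -- `D - N` is the posterior average of the quality minus `f q`. Its nonnegativity gives `N ≤ D`,
  -- so the truncation at `1` in `poolProb` is inactive; if `D = 0` then `N = 0`, and the default
  -- value of the quotient is harmless.
  have hDN : D - N = q - f q := by
    rw [hD, hN, ← Finset.sum_sub_distrib]
    have : ((q : ℝ) - f q) = ∑ j, M.posterior φ j s * ((M.quality j : ℝ) - f q) := by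
      simp only [mul_sub, Finset.sum_sub_distrib, ← Finset.sum_mul, h, one_mul]
      rw [hq, M.meanOf_eq h]
    rw [this]
    refine Finset.sum_congr rfl fun j _ => ?_
    split_ifs with hj
    · rw [hmax j hj]; ring
    · ring
  have hND : N ≤ D := by
    have : (f q : ℝ) ≤ q := hfle q
    linarith
  have hr : M.poolProb φ f s * D = N := by
    change min 1 (N / D) * D = N
    rcases eq_or_lt_of_le (hN0.trans hND) with h0 | h0
    · rw [← h0, mul_zero]
      linarith
    · rw [min_eq_right ((div_le_one h0).2 hND), div_mul_cancel₀ _ h0.ne']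
  have : ∑ i, M.posterior φ i s * (M.pool φ f i s * ((M.quality i : ℝ) - f q)) =
      M.poolProb φ f s * D - N := by
    rw [hD, hN, Finset.mul_sum, ← Finset.sum_sub_distrib]
    refine Finset.sum_congr rfl fun j _ => ?_
    unfold Market.pool
    rw [← hq]
    split_ifs with hj
    · rw [hmax j hj]; ring
    · ring
  rw [this, hr, sub_self]

/-- The advertising strategy obtained from a signaling scheme by pooling at the means `f q`. -/
def Market.roundedAdv (M : Market m) (φ : Fin m → Measure Sig)
    (f : unitInterval → unitInterval) (i : Fin m) : Measure unitInterval :=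
  revealLaw (φ i) (fun s => f (M.meanOf φ s)) (M.pool φ f i) (M.quality i)

/-- On a set `B` the imbalance of quality `i` is the integral of `M.quality i - q` over announced
means `q` in `B`. A revealed quality contributes zero because it announces itself, and the pools
contribute zero signal by signal by `Market.sum_pool`. -/
theorem Market.isFeasible_roundedAdv (hφ : IsScheme φ) (hf : Measurable f)
    (hfle : ∀ q, f q ≤ q) (hfq : ∀ q j, M.quality j ≤ q → M.quality j ≤ f q) :
    M.IsFeasible (M.roundedAdv φ f) := by
  have hF : Measurable fun s => f (M.meanOf φ s) := hf.comp (M.measurable_meanOf φ)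
  have hprob : ∀ i, IsProbabilityMeasure (M.roundedAdv φ f i) := fun i =>
    have := hφ i
    isProbabilityMeasure_revealLaw hF (M.measurable_pool hf i) (M.pool_nonneg hfle i)
      (M.pool_le_one i)
  refine ⟨hprob, fun B hB => ?_⟩
  classical
  let g : Fin m → unitInterval → ℝ := fun i => B.indicator fun q => (M.quality i : ℝ) - q
  have hg : ∀ i, Measurable (g i) := fun i =>
    (measurable_subtype_coe.const_sub _).indicator hB
  have hgb : ∀ i q, |g i q| ≤ 1 := fun i q => by
    by_cases hq : q ∈ B
    · simp only [g, Set.indicator_of_mem hq, abs_le]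
      constructor <;> linarith [(M.quality i).2.1, (M.quality i).2.2, q.2.1, q.2.2]
    · simp [g, Set.indicator_of_notMem hq]
  have h1 : ∀ i, (M.quality i : ℝ) * (M.roundedAdv φ f i).real B -
      ∫ q in B, (q : ℝ) ∂(M.roundedAdv φ f i) =
      ∫ s, M.pool φ f i s * g i (f (M.meanOf φ s)) ∂(φ i) := fun i => by
    have := hφ i
    have := hprob i
    have h2 := integral_revealLaw (φ := φ i) (r := M.pool φ f i) (w := M.quality i) hF (M.measurable_pool hf i)
      (M.pool_nonneg hfle i) (M.pool_le_one i) (hg i) (hgb i)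
    have h3 : g i (M.quality i) = 0 := by simp [g, Set.indicator_apply]
    simp only [h3, mul_zero, add_zero] at h2
    rw [← h2]
    change _ = ∫ q, g i q ∂(M.roundedAdv φ f i)
    have hc : Integrable (fun q : unitInterval => (q : ℝ)) (M.roundedAdv φ f i) :=
      integrable_of_abs_le measurable_subtype_coe (C := 1) fun q =>
        abs_le.2 ⟨by linarith [q.2.1], q.2.2⟩
    rw [integral_indicator hB, integral_sub (integrable_const _) hc.integrableOn,
      setIntegral_const, smul_eq_mul, mul_comm]
  have h4 := M.sum_prior_mul_integral hφ (h := fun i s => M.pool φ f i s * g i (f (M.meanOf φ s)))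
    fun i => by
      have := hφ i
      refine integrable_of_abs_le ((M.measurable_pool hf i).mul ((hg i).comp hF)) (C := 1)
        fun s => ?_
      rw [abs_mul, abs_of_nonneg (M.pool_nonneg hfle i s)]
      exact mul_le_one₀ (M.pool_le_one i s) (abs_nonneg _) (hgb i _)
  have h5 : ∫ s, ∑ i, M.posterior φ i s * (M.pool φ f i s * g i (f (M.meanOf φ s)))
      ∂(M.signalLaw φ) = 0 := by
    refine integral_eq_zero_of_ae ?_
    filter_upwards [M.sum_posterior hφ] with s hs
    by_cases hq : f (M.meanOf φ s) ∈ B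
    · simp only [g, Set.indicator_of_mem hq, Pi.zero_apply]
      exact M.sum_pool hfle hfq hs
    · simp [g, Set.indicator_of_notMem hq]
  rw [h5] at h4
  rw [← sub_eq_zero, ← Finset.sum_sub_distrib, ← h4]
  refine Finset.sum_congr rfl fun i _ => ?_
  rw [← h1 i]
  ring

/-- Every price and signaling scheme is matched, up to `2 ε`, by a candidate of the algorithm. -/
theorem Market.exists_candidate (hR : M.RegularValuation) (hL : M.LinearInQuality)
    (h1 : M.typeLaw {1} = 0) (hφ : IsScheme φ) {U ε p : ℝ} (hε : 0 < ε) (hpU : p ≤ U)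
    (hp : 2 * ε ≤ p) :
    ∃ p' ρ, M.IsCandidate U ε p' ρ ∧ M.schemeRevenue p φ ≤ M.revenue p' ρ + 2 * ε := by
  classical
  have hpε : 2 ≤ p / ε := (le_div_iff₀ hε).2 hp
  have hk2 : 2 ≤ ⌊p / ε⌋₊ := Nat.le_floor (by exact_mod_cast hpε)
  obtain ⟨k, hk⟩ : ∃ k, ⌊p / ε⌋₊ = k + 1 := ⟨⌊p / ε⌋₊ - 1, by omega⟩
  have hk1 : 1 ≤ k := by omega
  -- One grid step below the floor of `p`, so that `p' + ε ≤ p ≤ p' + 2 * ε`. The assumption `2 * ε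
  -- ≤ p` gives `k ≥ 1`, which is where the multiples in the price grid start.
  set p' : ℝ := k * ε with hp'
  have hfl : (k + 1 : ℝ) ≤ p / ε := by
    have := Nat.floor_le (by linarith : 0 ≤ p / ε)
    rw [hk] at this
    exact_mod_cast this
  have hfl2 : p / ε < k + 2 := by
    have := Nat.lt_floor_add_one (p / ε)
    rw [hk] at this
    push_cast at this
    linarith
  have hpp : p' + ε ≤ p := by
    have := (le_div_iff₀ hε).1 hfl
    rw [hp']
    linarith
  have hpp2 : p ≤ p' + 2 * ε := by
    have := (div_lt_iff₀ hε).1 hfl2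
    rw [hp']
    linarith
  have hp'0 : 0 ≤ p' := by positivity
  have hgrid : p' ∈ priceGrid U ε := by
    refine Finset.mem_insert_of_mem (Finset.mem_image.2 ⟨k, Finset.mem_Icc.2 ⟨hk1, ?_⟩, rfl⟩)
    refine Nat.le_floor ((le_div_iff₀ hε).2 ?_)
    rw [← hp']
    linarith
  set f := M.roundDown U ε p' with hf
  have hfm : Measurable f := (M.monotone_roundDown U ε p').measurable
  have hfle : ∀ q, f q ≤ q := M.roundDown_le U ε p'
  have hfq : ∀ q j, M.quality j ≤ q → M.quality j ≤ f q := fun q j hj =>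
    M.le_roundDown (M.quality_mem_allowedMeans hgrid j) hj
  -- The truncation in `meanOf` gives this for every signal and not just almost every one, so the
  -- rounded mean is allowed everywhere.
  have hlow : ∀ s, M.quality M.lowest ≤ M.meanOf φ s := fun s => le_max_left _ _
  have hF : Measurable fun s => f (M.meanOf φ s) := hfm.comp (M.measurable_meanOf φ)
  refine ⟨p', M.roundedAdv φ f, ⟨hgrid, M.isFeasible_roundedAdv hφ hfm hfle hfq, fun i => ?_⟩, ?_⟩
  · exact revealLaw_compl_eq_zero (M.isClosed_allowedMeans hR hL U ε p').measurableSet hF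
      (fun s => M.roundDown_mem hR hL (M.quality_mem_allowedMeans hgrid M.lowest) (hlow s))
      (M.quality_mem_allowedMeans hgrid i)
  rw [M.schemeRevenue_eq hR hL h1 hφ, hR.revenue_eq h1]
  have hdm : ∀ p, Measurable fun q => M.demand (M.criticalType p q) := fun p =>
    M.antitone_demand.measurable.comp (hR.antitone_criticalType p).measurable
  have hdb : ∀ x, |M.demand x| ≤ 1 := fun x =>
    abs_le.2 ⟨by linarith [M.demand_nonneg x], M.demand_le_one x⟩
  set X := fun i => ∫ s, M.demand (M.criticalType p (M.meanOf φ s)) ∂(φ i) with hX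
  set Y := fun i => ∫ q, M.demand (M.criticalType p' q) ∂(M.roundedAdv φ f i) with hY
  have hX1 : ∀ i, X i ≤ 1 := fun i => by
    have := hφ i
    calc X i ≤ ∫ _, (1 : ℝ) ∂(φ i) := integral_mono_of_nonneg
          (Filter.Eventually.of_forall fun s => M.demand_nonneg _) (integrable_const _)
          (Filter.Eventually.of_forall fun s => M.demand_le_one _)
      _ = 1 := by simp
  have hXY : ∀ i, X i ≤ Y i := fun i => by
    have := hφ i
    have h2 := integral_revealLaw (φ := φ i) (r := M.pool φ f i) (w := M.quality i) hF (M.measurable_pool hfm i)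
      (M.pool_nonneg hfle i) (M.pool_le_one i) (hdm p') (fun q => hdb _)
    change _ ≤ ∫ q, _ ∂(revealLaw _ _ _ _)
    rw [h2]
    refine integral_mono_of_nonneg (Filter.Eventually.of_forall fun s => M.demand_nonneg _) ?_
      (Filter.Eventually.of_forall fun s => ?_)
    · refine integrable_of_abs_le ?_ (C := 1) fun s => ?_
      · exact ((M.measurable_pool hfm i).mul ((hdm p').comp hF)).add
          (((M.measurable_pool hfm i).const_sub 1).mul_const _)
      · have a1 := M.pool_nonneg (φ := φ) hfle i s
        have a2 := M.pool_le_one (φ := φ) (f := f) i s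
        have a3 := M.demand_nonneg (M.criticalType p' (f (M.meanOf φ s)))
        have a4 := M.demand_le_one (M.criticalType p' (f (M.meanOf φ s)))
        have a5 := M.demand_nonneg (M.criticalType p' (M.quality i))
        have a6 := M.demand_le_one (M.criticalType p' (M.quality i))
        rw [abs_le]
        constructor <;> nlinarith
    -- The comparison is made type by type. Pooled buyers are kept because of the price cut; a
    -- revealed quality above the mean is worth at least as much, at a lower price.
    · have key : ∀ q', (∀ θ, p ≤ M.v θ (M.meanOf φ s) → M.criticalType p' q' ≤ θ) →
          M.demand (M.criticalType p (M.meanOf φ s)) ≤ M.demand (M.criticalType p' q') := by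
        intro q' h
        have := M.typeLaw_prob
        rw [← hR.typeLaw_purchase h1]
        exact measureReal_mono h
      have b1 := key (f (M.meanOf φ s)) fun θ hθ =>
        M.criticalType_roundDown_le_of_purchase hR hL hε hgrid hpp (hlow s) hθ
      have a1 := M.pool_nonneg (φ := φ) hfle i s
      have a2 := M.pool_le_one (φ := φ) (f := f) i s
      change M.demand (M.criticalType p (M.meanOf φ s)) ≤ _
      beta_reduce
      by_cases hi : M.quality i ≤ M.meanOf φ s
      · have : M.pool φ f i s = 1 := if_pos hi
        rw [this]
        linarith
      · have b2 := key (M.quality i) fun θ hθ => hR.criticalType_le_iff.2 (Or.inr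
          ((by linarith : p' ≤ p).trans (hθ.trans (hR.monotone_quality θ (not_le.1 hi).le))))
        nlinarith
  have hsum : ∑ i, M.prior i * X i ≤ ∑ i, M.prior i * Y i :=
    Finset.sum_le_sum fun i _ => mul_le_mul_of_nonneg_left (hXY i) (M.prior_nonneg i)
  have hsum1 : ∑ i, M.prior i * X i ≤ 1 := by
    rw [← M.prior_sum]
    exact Finset.sum_le_sum fun i _ => mul_le_of_le_one_right (M.prior_nonneg i) (hX1 i)
  have hX0 : 0 ≤ ∑ i, M.prior i * X i := Finset.sum_nonneg fun i _ =>
    mul_nonneg (M.prior_nonneg i) (integral_nonneg fun s => M.demand_nonneg _)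
  -- The price drop of at most `2 * ε` is multiplied by a purchase probability of at most one.
  nlinarith

theorem Market.schemeRevenue_le (hR : M.RegularValuation) (hL : M.LinearInQuality)
    (h1 : M.typeLaw {1} = 0) (hφ : IsScheme φ) {p : ℝ} (hp : 0 ≤ p) :
    M.schemeRevenue p φ ≤ p := by
  rw [M.schemeRevenue_eq hR hL h1 hφ]
  refine mul_le_of_le_one_right hp ?_
  rw [← M.prior_sum]
  refine Finset.sum_le_sum fun i _ => mul_le_of_le_one_right (M.prior_nonneg i) ?_
  have := hφ i
  calc _ ≤ ∫ _, (1 : ℝ) ∂(φ i) := integral_mono_of_nonneg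
        (Filter.Eventually.of_forall fun s => M.demand_nonneg _) (integrable_const _)
        (Filter.Eventually.of_forall fun s => M.demand_le_one _)
    _ = 1 := by simp

end

end

end PricingAds

/-! ### Confidence bonuses and the optimistic index -/

namespace PricingAds

noncomputable section

variable {m : ℕ} {M : Market m}

/-! ### The confidence bonus -/

/-- The confidence bonus after `n` visits. -/
def confBonus (T : ℕ) (n : ℝ) : ℝ :=
  √(16 * Real.log T / n) + √((1 + n) * Real.log (1 + n)) / n

theorem confBonus_nonneg (T n : ℕ) : 0 ≤ confBonus T n := by
  unfold confBonus
  positivity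

/-- Both terms are of order `√(log T / n)`: the first is four times this, and `1 + n ≤ 2 n` with `1
+ n ≤ T ^ 2` bounds the second by twice it. At `n = 0` both sides vanish by the convention for
division. -/
theorem confBonus_le {T n : ℕ} (hT : 2 ≤ T) (hn : n ≤ T) :
    confBonus T n ≤ 6 * (√(Real.log T) * (1 / √(n : ℝ))) := by
  unfold confBonus
  rcases Nat.eq_zero_or_pos n with rfl | h0
  · simp
  have hn0 : (0 : ℝ) < n := by exact_mod_cast h0
  have hn1 : (1 : ℝ) ≤ n := by exact_mod_cast h0
  have hT2 : (2 : ℝ) ≤ T := by exact_mod_cast hT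
  have hnT : (n : ℝ) ≤ T := by exact_mod_cast hn
  have hL : 0 ≤ Real.log T := Real.log_nonneg (by linarith)
  have h16 : √(16 * Real.log T / n) = 4 * (√(Real.log T) * (1 / √(n : ℝ))) := by
    rw [Real.sqrt_div (by positivity), Real.sqrt_mul (by norm_num),
      show (16 : ℝ) = 4 ^ 2 by norm_num, Real.sqrt_sq (by norm_num)]
    ring
  have hlog : Real.log (1 + n) ≤ 2 * Real.log T := by
    rw [← Real.log_rpow (by linarith)]
    refine Real.log_le_log (by linarith) ?_
    norm_num
    nlinarith
  have hlog0 : 0 ≤ Real.log (1 + n) := Real.log_nonneg (by linarith)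
  have h2 : √((1 + n) * Real.log (1 + n)) / n ≤ 2 * (√(Real.log T) * (1 / √(n : ℝ))) := by
    have h3 : √((1 + n) * Real.log (1 + n)) ≤ √(2 ^ 2 * (Real.log T * n)) := by
      refine Real.sqrt_le_sqrt ?_
      nlinarith [mul_le_mul (by linarith : 1 + (n : ℝ) ≤ 2 * n) hlog hlog0 (by positivity)]
    rw [Real.sqrt_mul (by norm_num : (0 : ℝ) ≤ 2 ^ 2) (Real.log T * n),
      Real.sqrt_sq (by norm_num : (0 : ℝ) ≤ 2), Real.sqrt_mul hL] at h3
    rw [div_le_iff₀ hn0]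
    have h4 : (1 / √(n : ℝ)) * n = √(n : ℝ) := by
      rw [one_div, inv_mul_eq_div, Real.div_sqrt]
    calc _ ≤ _ := h3
      _ = 2 * (√(Real.log T) * ((1 / √(n : ℝ)) * n)) := by rw [h4]
      _ = _ := by ring
  linarith

theorem priceGrid_nonneg {U ε p : ℝ} (hU : 0 ≤ U) (hε : 0 ≤ ε) (hp : p ∈ priceGrid U ε) :
    0 ≤ p := by
  classical
  rcases Finset.mem_insert.1 hp with rfl | h
  · exact hU
  · obtain ⟨k, _, rfl⟩ := Finset.mem_image.1 h
    positivity

theorem Market.revenue_nonneg (M : Market m) {p : ℝ} (hp : 0 ≤ p)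
    (ρ : Fin m → Measure unitInterval) : 0 ≤ M.revenue p ρ :=
  mul_nonneg hp (Finset.sum_nonneg fun i _ => mul_nonneg (M.prior_nonneg i)
    (integral_nonneg fun _ => measureReal_nonneg))

/-! ### Optimism of the confidence bounds -/

section Ucb

variable {U ε : ℝ} {T : ℕ} {Ω : Type*} [mΩ : MeasurableSpace Ω] {P : Measure Ω}
  {G : Interaction M U T P} {t : ℕ} {ω : Ω}

theorem Interaction.purchase_nonneg (G : Interaction M U T P) (t : ℕ) (ω : Ω) :
    0 ≤ G.purchase t ω := by
  unfold Interaction.purchase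
  split_ifs
  exacts [zero_le_one, le_rfl]

theorem Interaction.count_le (G : Interaction M U T P) (t : ℕ) (ω : Ω) (x : unitInterval) :
    (G.visits t ω x).card ≤ t := by
  classical
  exact (Finset.card_filter_le _ _).trans (Finset.card_range t).le

theorem Interaction.empDemand_nonneg (G : Interaction M U T P) (t : ℕ) (ω : Ω)
    (x : unitInterval) : 0 ≤ G.empDemand t ω x :=
  div_nonneg (Finset.sum_nonneg fun _ _ => G.purchase_nonneg _ _) (Nat.cast_nonneg _)

theorem Interaction.ucbDemand_nonneg (ε : ℝ) (x : unitInterval) : 0 ≤ G.ucbDemand ε t ω x := by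
  classical
  rw [Interaction.ucbDemand, Finset.le_fold_min]
  refine ⟨zero_le_one, fun x' _ => ?_⟩
  have h1 := G.empDemand_nonneg t ω x'
  have h2 := confBonus_nonneg T (G.visits t ω x').card
  unfold confBonus at h2
  rw [add_assoc]
  exact add_nonneg h1 h2

theorem Interaction.ucbDemand_le_one (ε : ℝ) (x : unitInterval) : G.ucbDemand ε t ω x ≤ 1 := by
  classical
  rw [Interaction.ucbDemand, Finset.fold_min_le]
  exact Or.inl le_rfl

/-- A larger argument admits more grid types into the minimum. This also supplies measurability of
the index. -/
theorem Interaction.antitone_ucbDemand (ε : ℝ) : Antitone (G.ucbDemand ε t ω) := by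
  classical
  intro x y hxy
  simp only [Interaction.ucbDemand]
  rw [Finset.le_fold_min]
  refine ⟨(Finset.fold_min_le _).2 (Or.inl le_rfl), fun x' hx' => (Finset.fold_min_le _).2
    (Or.inr ⟨x', ?_, le_rfl⟩)⟩
  rw [Finset.mem_filter] at hx' ⊢
  exact ⟨hx'.1, hx'.2.trans hxy⟩

/-- All empirical demands on the grid are within the confidence radius. -/
def Interaction.Concentrated (G : Interaction M U T P) (ε : ℝ) (t : ℕ) (ω : Ω) : Prop :=
  ∀ x ∈ M.typeGrid U ε,
    |G.empDemand t ω x - M.demand x| ≤ √(16 * Real.log T / G.count t ω x)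

/-- Each index at a grid type `x' ≤ x` is at least the demand at `x'`, hence at least the demand at
`x`. The bound therefore holds off the grid too, so it applies to any feasible strategy. -/
theorem Interaction.Concentrated.demand_le (h : G.Concentrated ε t ω) (x : unitInterval) :
    M.demand x ≤ G.ucbDemand ε t ω x := by
  classical
  rw [Interaction.ucbDemand, Finset.le_fold_min]
  refine ⟨M.demand_le_one x, fun x' hx' => ?_⟩
  rw [Finset.mem_filter] at hx'
  have h1 := (abs_le.1 (h x' hx'.1)).1
  have h2 := M.antitone_demand hx'.2
  have h3 : 0 ≤ √((1 + G.count t ω x') * Real.log (1 + G.count t ω x')) / G.count t ω x' :=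
    div_nonneg (Real.sqrt_nonneg _) (Nat.cast_nonneg _)
  linarith

theorem Interaction.Concentrated.le_demand (h : G.Concentrated ε t ω) {x : unitInterval}
    (hx : x ∈ M.typeGrid U ε) :
    G.ucbDemand ε t ω x ≤ M.demand x + 2 * confBonus T (G.count t ω x) := by
  classical
  rw [Interaction.ucbDemand, Finset.fold_min_le]
  refine Or.inr ⟨x, Finset.mem_filter.2 ⟨hx, le_rfl⟩, ?_⟩
  have h1 := (abs_le.1 (h x hx)).2
  have h3 : 0 ≤ √((1 + G.count t ω x) * Real.log (1 + G.count t ω x)) / G.count t ω x :=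
    div_nonneg (Real.sqrt_nonneg _) (Nat.cast_nonneg _)
  unfold confBonus
  linarith

theorem Interaction.integrable_ucbDemand (hR : M.RegularValuation) (p : ℝ)
    (ρ : Measure unitInterval) [IsFiniteMeasure ρ] :
    Integrable (fun q => G.ucbDemand ε t ω (M.criticalType p q)) ρ :=
  integrable_of_abs_le ((G.antitone_ucbDemand ε).measurable.comp
    (hR.antitone_criticalType p).measurable) (C := 1) fun q =>
      abs_le.2 ⟨by linarith [G.ucbDemand_nonneg (t := t) (ω := ω) ε (M.criticalType p q)],
        G.ucbDemand_le_one ε _⟩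

theorem Market.integrable_demand (hR : M.RegularValuation) (p : ℝ)
    (ρ : Measure unitInterval) [IsFiniteMeasure ρ] :
    Integrable (fun q => M.demand (M.criticalType p q)) ρ :=
  integrable_of_abs_le (M.antitone_demand.measurable.comp
    (hR.antitone_criticalType p).measurable) (C := 1) fun q =>
      abs_le.2 ⟨by linarith [M.demand_nonneg (M.criticalType p q)], M.demand_le_one _⟩

theorem Interaction.Concentrated.revenue_le (h : G.Concentrated ε t ω)
    (hR : M.RegularValuation) (h1 : M.typeLaw {1} = 0) {p : ℝ} (hp : 0 ≤ p)
    {ρ : Fin m → Measure unitInterval} (hρ : M.IsFeasible ρ) :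
    M.revenue p ρ ≤ G.ucbRevenue ε t ω p ρ := by
  rw [hR.revenue_eq h1]
  refine mul_le_mul_of_nonneg_left (Finset.sum_le_sum fun i _ =>
    mul_le_mul_of_nonneg_left ?_ (M.prior_nonneg i)) hp
  have := hρ.1 i
  exact integral_mono (M.integrable_demand hR p _) (G.integrable_ucbDemand hR p _)
    fun q => h.demand_le _

/-- The probability that the critical type at price `p` and strategy `ρ` is `x`. -/
def Market.hitProb (M : Market m) (p : ℝ) (ρ : Fin m → Measure unitInterval)
    (x : unitInterval) : ℝ :=
  ∑ i, M.prior i * (ρ i).real {q | M.criticalType p q = x}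

theorem Market.hitProb_nonneg (p : ℝ) (ρ : Fin m → Measure unitInterval) (x : unitInterval) :
    0 ≤ M.hitProb p ρ x :=
  Finset.sum_nonneg fun i _ => mul_nonneg (M.prior_nonneg i) measureReal_nonneg

theorem Market.measurableSet_hit (hR : M.RegularValuation) (p : ℝ) (x : unitInterval) :
    MeasurableSet {q | M.criticalType p q = x} :=
  (hR.antitone_criticalType p).measurable (measurableSet_singleton x)

/-- Almost every mean announced by a candidate has its critical type on the grid, where the index
exceeds the demand by at most twice the bonus. Splitting according to the critical type reached
produces the weights `hitProb`. -/
theorem Interaction.Concentrated.ucbRevenue_le (h : G.Concentrated ε t ω)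
    (hR : M.RegularValuation) (h1 : M.typeLaw {1} = 0) {p : ℝ} (hp : 0 ≤ p)
    {ρ : Fin m → Measure unitInterval} (hρ : M.IsCandidate U ε p ρ) :
    G.ucbRevenue ε t ω p ρ ≤ M.revenue p ρ +
      p * (2 * ∑ x ∈ M.typeGrid U ε, confBonus T (G.count t ω x) * M.hitProb p ρ x) := by
  classical
  set b : unitInterval → ℝ := fun x => confBonus T (G.count t ω x) with hb
  have key : ∀ i, ∫ q, G.ucbDemand ε t ω (M.criticalType p q) ∂(ρ i) ≤
      ∫ q, M.demand (M.criticalType p q) ∂(ρ i) +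
        2 * ∑ x ∈ M.typeGrid U ε, b x * (ρ i).real {q | M.criticalType p q = x} := fun i => by
    have := hρ.2.1.1 i
    have hind : ∀ x, Integrable (fun q =>
        ({q | M.criticalType p q = x} : Set unitInterval).indicator (fun _ => (1 : ℝ)) q) (ρ i) :=
      fun x => (integrable_const 1).indicator (M.measurableSet_hit hR p x)
    have hs : Integrable (fun q => 2 * ∑ x ∈ M.typeGrid U ε, b x *
        ({q | M.criticalType p q = x} : Set unitInterval).indicator (fun _ => (1 : ℝ)) q) (ρ i) :=
      (integrable_finsetSum _ fun x _ => (hind x).const_mul _).const_mul _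
    have e1 : 2 * ∑ x ∈ M.typeGrid U ε, b x * (ρ i).real {q | M.criticalType p q = x} =
        ∫ q, 2 * ∑ x ∈ M.typeGrid U ε, b x *
          ({q | M.criticalType p q = x} : Set unitInterval).indicator (fun _ => (1 : ℝ)) q
          ∂(ρ i) := by
      rw [integral_const_mul, integral_finsetSum _ fun x _ => (hind x).const_mul _]
      congr 1
      refine Finset.sum_congr rfl fun x _ => ?_
      rw [integral_const_mul, integral_indicator_const _ (M.measurableSet_hit hR p x)]
      simp
    rw [e1, ← integral_add (M.integrable_demand hR p _) hs]
    refine integral_mono_ae (G.integrable_ucbDemand hR p _)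
      ((M.integrable_demand hR p _).add hs) ?_
    filter_upwards [compl_mem_ae_iff.2 (hρ.2.2 i)] with q hq
    have hq' : M.criticalType p q ∈ M.typeGrid U ε := not_not.1 hq
    have e2 : ∑ x ∈ M.typeGrid U ε, b x *
        ({q | M.criticalType p q = x} : Set unitInterval).indicator (fun _ => (1 : ℝ)) q =
        b (M.criticalType p q) := by
      rw [Finset.sum_eq_single_of_mem _ hq']
      · simp
      · intro x _ hx
        simp [hx.symm]
    rw [e2]
    exact h.le_demand hq'
  rw [hR.revenue_eq h1, ← mul_add]
  refine mul_le_mul_of_nonneg_left ?_ hp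
  calc _ ≤ ∑ i, M.prior i * (∫ q, M.demand (M.criticalType p q) ∂(ρ i) +
        2 * ∑ x ∈ M.typeGrid U ε, b x * (ρ i).real {q | M.criticalType p q = x}) :=
        Finset.sum_le_sum fun i _ => mul_le_mul_of_nonneg_left (key i) (M.prior_nonneg i)
    _ = _ := by
      simp only [mul_add, Finset.sum_add_distrib, Market.hitProb, Finset.mul_sum]
      congr 1
      rw [Finset.sum_comm]
      exact Finset.sum_congr rfl fun x _ => Finset.sum_congr rfl fun i _ => by ring

/-- The regret of a round on the event that the empirical demands are concentrated. -/
theorem Interaction.Concentrated.bestRevenue_le (h : G.Concentrated ε t ω)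
    (hG : G.FollowsAlgorithm ε) (ht : t < T) (hcard : (M.typeGrid U ε).card ≤ t)
    (hR : M.RegularValuation) (hL : M.LinearInQuality) (h1 : M.typeLaw {1} = 0)
    (hU : 0 < U) (hε : 0 < ε) (Sig : Type*) [MeasurableSpace Sig] :
    M.bestRevenue U Sig ≤ M.revenue (G.price t ω) (G.adv t ω) + 2 * ε +
      2 * U * ∑ x ∈ M.typeGrid U ε, confBonus T (G.count t ω x) *
        M.hitProb (G.price t ω) (G.adv t ω) x := by
  have hp := G.price_mem t ht ω
  have hrev := M.revenue_nonneg hp.1 (G.adv t ω)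
  have hsum : 0 ≤ ∑ x ∈ M.typeGrid U ε, confBonus T (G.count t ω x) *
      M.hitProb (G.price t ω) (G.adv t ω) x :=
    Finset.sum_nonneg fun x _ => mul_nonneg (confBonus_nonneg T _) (M.hitProb_nonneg _ _ _)
  have hpU : G.price t ω * (2 * ∑ x ∈ M.typeGrid U ε, confBonus T (G.count t ω x) *
      M.hitProb (G.price t ω) (G.adv t ω) x) ≤ 2 * U * ∑ x ∈ M.typeGrid U ε,
        confBonus T (G.count t ω x) * M.hitProb (G.price t ω) (G.adv t ω) x := by
    nlinarith [mul_le_mul_of_nonneg_right hp.2 hsum]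
  have hpos := mul_nonneg (by positivity : 0 ≤ 2 * U) hsum
  -- The bound must be nonnegative because with an empty signal space there is no scheme, and the
  -- supremum is `0` by convention.
  refine Real.sSup_le ?_ (by linarith)
  rintro r ⟨p, ⟨hp0, hp1⟩, φ, hφ, rfl⟩
  -- A price below `2 * ε` earns less than `2 * ε`. For other prices: the benchmark is within `2 *
  -- ε` of a candidate, whose revenue is at most its index, which is at most the index of the pair
  -- played, which exceeds the true revenue by bonuses only.
  rcases le_or_gt (2 * ε) p with hpε | hpε
  · obtain ⟨p', ρ, hc, hle⟩ := M.exists_candidate hR hL h1 hφ hε hp1 hpε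
    have a1 := h.revenue_le hR h1 (priceGrid_nonneg hU.le hε.le hc.1) hc.2.1
    have a2 := hG.optimal ω t ht hcard p' ρ hc
    have a3 := h.ucbRevenue_le hR h1 hp.1 (hG.candidate ω t ht hcard)
    linarith
  · have := M.schemeRevenue_le hR hL h1 hφ hp0
    linarith

theorem Market.bestRevenue_le (hR : M.RegularValuation) (hL : M.LinearInQuality)
    (h1 : M.typeLaw {1} = 0) (hU : 0 ≤ U) (Sig : Type*) [MeasurableSpace Sig] :
    M.bestRevenue U Sig ≤ U := by
  refine Real.sSup_le ?_ hU
  rintro r ⟨p, ⟨hp0, hp1⟩, φ, hφ, rfl⟩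
  exact (M.schemeRevenue_le hR hL h1 hφ hp0).trans hp1

end Ucb

end

end PricingAds

/-! ### Conditional law of a round and concentration -/

namespace PricingAds

open ProbabilityTheory

noncomputable section

variable {m : ℕ} {M : Market m}

/-! ### The law of a round given the past -/

section Law

variable {U : ℝ} {T : ℕ} {Ω : Type*} [mΩ : MeasurableSpace Ω] {P : Measure Ω}
  (G : Interaction M U T P) {t : ℕ}

/-- The conditional probability, given the past, that the posterior mean of round `t` is in `A`. -/
def Interaction.postProb (t : ℕ) (A : Set unitInterval) (ω : Ω) : ℝ :=
  ∑ i, M.prior i * (G.adv t ω i).real A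

variable {G}

theorem Interaction.measurable_price (ht : t < T) : Measurable (G.price t) :=
  (G.price_measurable t ht).mono (G.ℱ.le t) le_rfl

theorem Interaction.measurable_post (ht : t < T) : Measurable (G.post t) :=
  (G.post_measurable t ht).mono (G.ℱ.le _) le_rfl

theorem Interaction.measurable_adv_real (ht : t < T) (i : Fin m) {A : Set unitInterval}
    (hA : MeasurableSet A) : Measurable[G.ℱ t] fun ω => (G.adv t ω i).real A :=
  ((Measure.measurable_coe hA).comp
    ((measurable_pi_apply i).comp (G.adv_measurable t ht))).ennreal_toReal

theorem Interaction.measurable_postProb (ht : t < T) {A : Set unitInterval}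
    (hA : MeasurableSet A) : Measurable[G.ℱ t] (G.postProb t A) :=
  Finset.measurable_sum _ fun i _ => (G.measurable_adv_real ht i hA).const_mul _

theorem Interaction.postProb_nonneg (A : Set unitInterval) (ω : Ω) : 0 ≤ G.postProb t A ω :=
  Finset.sum_nonneg fun i _ => mul_nonneg (M.prior_nonneg i) measureReal_nonneg

theorem Interaction.postProb_le_one (ht : t < T) (A : Set unitInterval) (ω : Ω) :
    G.postProb t A ω ≤ 1 := by
  rw [← M.prior_sum]
  refine Finset.sum_le_sum fun i _ => mul_le_of_le_one_right (M.prior_nonneg i) ?_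
  have := (G.adv_feasible t ht ω).1 i
  exact measureReal_le_one

theorem Interaction.measureReal_post_type [IsProbabilityMeasure P] (ht : t < T) {B : Set Ω}
    (hB : MeasurableSet[G.ℱ t] B) {A C : Set unitInterval} (hA : MeasurableSet A)
    (hC : MeasurableSet C) :
    P.real (B ∩ {ω | G.post t ω ∈ A ∧ G.type t ω ∈ C}) =
      (∫ ω in B, G.postProb t A ω ∂P) * M.typeLaw.real C := by
  have hq : Measurable (G.qual t) := (G.qual_measurable t ht).mono (G.ℱ.le _) le_rfl
  have h1 : B ∩ {ω | G.post t ω ∈ A ∧ G.type t ω ∈ C} =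
      ⋃ i, B ∩ {ω | G.qual t ω = i ∧ G.post t ω ∈ A ∧ G.type t ω ∈ C} := by
    ext ω
    simp
  have h2 : ∀ i, Integrable (fun ω => M.prior i * (G.adv t ω i).real A) P := fun i => by
    refine (integrable_of_abs_le ((G.measurable_adv_real ht i hA).mono (G.ℱ.le t) le_rfl)
      (C := 1) fun ω => ?_).const_mul _
    have := (G.adv_feasible t ht ω).1 i
    rw [abs_of_nonneg measureReal_nonneg]
    exact measureReal_le_one
  rw [h1, measureReal_iUnion_fintype]
  · simp only [G.law t ht B hB _ A C hA hC]
    rw [← Finset.sum_mul]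
    unfold Interaction.postProb
    rw [integral_finsetSum _ fun i _ => (h2 i).integrableOn]
  · intro i j hij
    refine Set.disjoint_left.2 ?_
    rintro ω ⟨_, h, _⟩ ⟨_, h', _⟩
    exact hij (h.symm.trans h')
  · intro i
    refine ((G.ℱ.le t) _ hB).inter ?_
    exact (hq (measurableSet_singleton i)).inter
      ((G.measurable_post ht hA).inter (G.type_measurable t ht hC))

theorem Interaction.measureReal_post [IsProbabilityMeasure P] (ht : t < T) {B : Set Ω}
    (hB : MeasurableSet[G.ℱ t] B) {A : Set unitInterval} (hA : MeasurableSet A) :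
    P.real (B ∩ G.post t ⁻¹' A) = ∫ ω in B, G.postProb t A ω ∂P := by
  have := G.measureReal_post_type ht hB hA MeasurableSet.univ
  have h1 := M.typeLaw_prob
  rw [probReal_univ, mul_one] at this
  rw [← this]
  congr 1
  ext ω
  simp

theorem Interaction.map_type [IsProbabilityMeasure P] (ht : t < T) :
    P.map (G.type t) = M.typeLaw := by
  have h1 := M.typeLaw_prob
  ext C hC
  have h2 := G.measureReal_post_type ht (MeasurableSet.univ) MeasurableSet.univ hC
  have h3 := G.measureReal_post ht MeasurableSet.univ MeasurableSet.univ
  rw [← h3] at h2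
  simp only [Set.mem_univ, true_and, Set.univ_inter, Set.preimage_univ, probReal_univ,
    one_mul] at h2
  rw [Measure.map_apply (G.type_measurable t ht) hC]
  exact (measureReal_eq_measureReal_iff (measure_ne_top _ _) (measure_ne_top _ _)).1 h2

/-- The information available when the buyer of round `t` decides: the past and the announced
posterior mean. -/
@[reducible]
def Interaction.interim (G : Interaction M U T P) (t : ℕ) : MeasurableSpace Ω :=
  G.ℱ t ⊔ MeasurableSpace.comap (G.post t) inferInstance

theorem Interaction.interim_le (ht : t < T) : G.interim t ≤ mΩ :=
  sup_le (G.ℱ.le t) (G.measurable_post ht).comap_le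

/-- Intersections of a past event with an event about the announced mean form a π-system generating
`interim`, and the law of the round factorizes on it. Independence from the past alone would not do,
since the realized critical type depends on the announced mean. -/
theorem Interaction.indep_type [IsProbabilityMeasure P] (ht : t < T) :
    Indep (G.interim t) (MeasurableSpace.comap (G.type t) inferInstance) P := by
  refine IndepSets.indep (p1 := {s | ∃ B A, MeasurableSet[G.ℱ t] B ∧ MeasurableSet A ∧
    s = B ∩ G.post t ⁻¹' A}) (p2 := {s | ∃ C, MeasurableSet C ∧ G.type t ⁻¹' C = s})
    (G.interim_le ht) (G.type_measurable t ht).comap_le ?_ ?_ ?_ ?_ ?_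
  · rintro _ ⟨B, A, hB, hA, rfl⟩ _ ⟨B', A', hB', hA', rfl⟩ _
    exact ⟨B ∩ B', A ∩ A', hB.inter hB', hA.inter hA', by rw [Set.preimage_inter,
      Set.inter_inter_inter_comm]⟩
  · rintro _ ⟨C, hC, rfl⟩ _ ⟨C', hC', rfl⟩ _
    exact ⟨C ∩ C', hC.inter hC', rfl⟩
  · refine le_antisymm (sup_le ?_ ?_) (MeasurableSpace.generateFrom_le ?_)
    · intro B hB
      exact MeasurableSpace.measurableSet_generateFrom
        ⟨B, Set.univ, hB, MeasurableSet.univ, by simp⟩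
    · rintro _ ⟨A, hA, rfl⟩
      exact MeasurableSpace.measurableSet_generateFrom
        ⟨Set.univ, A, MeasurableSet.univ, hA, by simp⟩
    · rintro _ ⟨B, A, hB, hA, rfl⟩
      exact MeasurableSet.inter ((le_sup_left : G.ℱ t ≤ G.interim t) _ hB)
        ((le_sup_right : MeasurableSpace.comap (G.post t) inferInstance ≤ G.interim t) _
          ⟨A, hA, rfl⟩)
  · refine le_antisymm ?_ (MeasurableSpace.generateFrom_le ?_)
    · rintro _ ⟨C, hC, rfl⟩
      exact MeasurableSpace.measurableSet_generateFrom ⟨C, hC, rfl⟩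
    · rintro _ ⟨C, hC, rfl⟩
      exact ⟨C, hC, rfl⟩
  · rw [IndepSets_iff]
    rintro _ _ ⟨B, A, hB, hA, rfl⟩ ⟨C, hC, rfl⟩
    have h1 := G.measureReal_post_type ht hB hA hC
    rw [← G.measureReal_post ht hB hA, ← G.map_type ht,
      map_measureReal_apply (G.type_measurable t ht) hC] at h1
    have h2 : B ∩ G.post t ⁻¹' A ∩ G.type t ⁻¹' C =
        B ∩ {ω | G.post t ω ∈ A ∧ G.type t ω ∈ C} := by
      rw [Set.inter_assoc]
      rfl
    rw [h2, ← ENNReal.toReal_eq_toReal_iff' (measure_ne_top _ _)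
      (ENNReal.mul_ne_top (measure_ne_top _ _) (measure_ne_top _ _)), ENNReal.toReal_mul]
    exact h1

/-- Conditioning a bounded weight on the past. -/
theorem Interaction.integral_mul_postProb [IsProbabilityMeasure P] (ht : t < T) {V : Ω → ℝ}
    (hV : Measurable[G.ℱ t] V) {c : ℝ} (hc : ∀ ω, |V ω| ≤ c) {A : Set unitInterval}
    (hA : MeasurableSet A) :
    ∫ ω, V ω * G.postProb t A ω ∂P =
      ∫ ω, V ω * (G.post t ⁻¹' A).indicator (fun _ => 1) ω ∂P := by
  have hAm : MeasurableSet (G.post t ⁻¹' A) := G.measurable_post ht hA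
  have hint : Integrable ((G.post t ⁻¹' A).indicator fun _ => (1 : ℝ)) P :=
    (integrable_const 1).indicator hAm
  have hpp : Integrable (G.postProb t A) P :=
    integrable_of_abs_le ((G.measurable_postProb ht hA).mono (G.ℱ.le t) le_rfl) (C := 1)
      fun ω => by
        rw [abs_of_nonneg (G.postProb_nonneg A ω)]
        exact G.postProb_le_one ht A ω
  -- The law of the round says exactly that `postProb` is the conditional probability given the
  -- past; the weight `V` then passes through the conditional expectation.
  have h1 : G.postProb t A =ᵐ[P] P[(G.post t ⁻¹' A).indicator fun _ => (1 : ℝ) | G.ℱ t] := by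
    refine ae_eq_condExp_of_forall_setIntegral_eq (G.ℱ.le t) hint
      (fun _ _ _ => hpp.integrableOn) (fun B hB _ => ?_)
      (G.measurable_postProb ht hA).aestronglyMeasurable
    rw [← G.measureReal_post ht hB hA, setIntegral_indicator hAm, setIntegral_const]
    simp
  have h2 := condExp_stronglyMeasurable_mul_of_bound (G.ℱ.le t) hV.stronglyMeasurable hint c
    (Filter.Eventually.of_forall hc)
  calc ∫ ω, V ω * G.postProb t A ω ∂P
      = ∫ ω, (P[V * (G.post t ⁻¹' A).indicator fun _ => (1 : ℝ) | G.ℱ t]) ω ∂P := by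
        refine integral_congr_ae ?_
        filter_upwards [h1, h2] with ω h3 h4
        rw [h4, Pi.mul_apply, h3]
    _ = _ := integral_condExp (G.ℱ.le t)

theorem Interaction.post_ae_eq [IsProbabilityMeasure P] (ht : t < T) {q₀ : unitInterval}
    (h : ∀ ω i, G.adv t ω i = Measure.dirac q₀) : ∀ᵐ ω ∂P, G.post t ω = q₀ := by
  have h1 := G.measureReal_post ht MeasurableSet.univ (measurableSet_singleton q₀).compl
  have h2 : ∀ ω, G.postProb t {q₀}ᶜ ω = 0 := fun ω => by
    simp [Interaction.postProb, h, measureReal_def]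
  simp only [h2, integral_zero, Set.univ_inter] at h1
  exact (measureReal_eq_zero_iff (measure_ne_top _ _)).1 h1

/-! ### Critical types and purchases -/

/-- The critical type realized in round `t`. -/
def Interaction.crit (G : Interaction M U T P) (t : ℕ) (ω : Ω) : unitInterval :=
  M.criticalType (G.price t ω) (G.post t ω)

theorem Interaction.measurable_crit_interim (hR : M.RegularValuation) (hL : M.LinearInQuality)
    (ht : t < T) : Measurable[G.interim t] (G.crit t) := by
  have h1 : Measurable[G.interim t] (G.price t) :=
    (G.price_measurable t ht).mono le_sup_left le_rfl
  have h2 : Measurable[G.interim t] (G.post t) :=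
    (comap_measurable (G.post t)).mono le_sup_right le_rfl
  exact (hR.continuous_criticalType hL).measurable.comp (h1.prodMk h2)

theorem Interaction.measurable_crit (hR : M.RegularValuation) (hL : M.LinearInQuality)
    (ht : t < T) : Measurable[G.ℱ (t + 1)] (G.crit t) := by
  have h1 : Measurable[G.ℱ (t + 1)] (G.price t) :=
    (G.price_measurable t ht).mono (G.ℱ.mono (Nat.le_succ t)) le_rfl
  exact (hR.continuous_criticalType hL).measurable.comp (h1.prodMk (G.post_measurable t ht))

theorem Interaction.measurable_purchase (ht : t < T) :
    Measurable[G.ℱ (t + 1)] (G.purchase t) := by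
  classical
  exact Measurable.ite (G.purchase_measurable t ht) measurable_const measurable_const

theorem Interaction.purchase_ae_eq [IsProbabilityMeasure P] (hR : M.RegularValuation)
    (h1 : M.typeLaw {1} = 0) (ht : t < T) :
    ∀ᵐ ω ∂P, G.purchase t ω = (Set.Ici (G.crit t ω)).indicator (fun _ => 1) (G.type t ω) := by
  classical
  have h2 : ∀ᵐ ω ∂P, G.type t ω ≠ 1 := by
    have h3 : P.map (G.type t) {1} = 0 := by rw [G.map_type ht, h1]
    rw [Measure.map_apply (G.type_measurable t ht) (measurableSet_singleton _)] at h3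
    exact compl_mem_ae_iff.2 h3
  filter_upwards [h2] with ω hω
  have h4 : G.price t ω ≤ M.v (G.type t ω) (G.post t ω) ↔ G.type t ω ∈ Set.Ici (G.crit t ω) :=
    ⟨fun h => hR.criticalType_le_iff.2 (Or.inr h),
      fun h => (hR.criticalType_le_iff.1 h).resolve_left hω⟩
  rw [Interaction.purchase, Set.indicator_apply]
  simp only [h4]

end Law

end

end PricingAds

namespace PricingAds

open ProbabilityTheory

noncomputable section

variable {m : ℕ} {M : Market m}

/-! ### Concentration of the empirical demand -/

/-- Hoeffding's lemma for the purchase indicator. -/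
theorem Market.lintegral_exp_indicator_le (M : Market m) (x : unitInterval) (l : ℝ) :
    ∫⁻ θ, ENNReal.ofReal (Real.exp (l * ((Set.Ici x).indicator (fun _ => 1) θ - M.demand x) -
      l ^ 2 / 8)) ∂M.typeLaw ≤ 1 := by
  have := M.typeLaw_prob
  have hm : Measurable ((Set.Ici x).indicator fun _ : unitInterval => (1 : ℝ)) :=
    measurable_const.indicator measurableSet_Ici
  have hb : ∀ θ, (Set.Ici x).indicator (fun _ : unitInterval => (1 : ℝ)) θ ∈ Set.Icc (0 : ℝ) 1 :=
    fun θ => by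
      rw [Set.indicator_apply]
      split_ifs <;> simp
  have h1 := hasSubgaussianMGF_of_mem_Icc (μ := M.typeLaw) hm.aemeasurable
    (Filter.Eventually.of_forall hb)
  have h2 : ∫ θ, (Set.Ici x).indicator (fun _ : unitInterval => (1 : ℝ)) θ ∂M.typeLaw =
      M.demand x := by
    rw [integral_indicator_const _ measurableSet_Ici]
    simp [Market.demand]
  rw [h2] at h1
  have h3 := h1.mgf_le l
  have h4 := h1.integrable_exp_mul l
  have h5 : ∀ θ, Real.exp (l * ((Set.Ici x).indicator (fun _ => 1) θ - M.demand x) - l ^ 2 / 8) =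
      Real.exp (l * ((Set.Ici x).indicator (fun _ => 1) θ - M.demand x)) *
        Real.exp (-(l ^ 2 / 8)) := fun θ => by
    rw [← Real.exp_add]
    ring_nf
  simp only [h5]
  rw [← ofReal_integral_eq_lintegral_ofReal (h4.mul_const _)
    (Filter.Eventually.of_forall fun θ => by positivity), integral_mul_const,
    ENNReal.ofReal_le_one]
  -- A variable in an interval of length one has variance proxy `1 / 4`, hence the compensator `l ^
  -- 2 / 8`.
  have h6 : (((‖(1 : ℝ) - 0‖₊ / 2) ^ 2 : NNReal) : ℝ) * l ^ 2 / 2 = l ^ 2 / 8 := by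
    simp
    ring
  rw [h6] at h3
  calc _ ≤ Real.exp (l ^ 2 / 8) * Real.exp (-(l ^ 2 / 8)) :=
        mul_le_mul_of_nonneg_right h3 (Real.exp_pos _).le
    _ = 1 := by rw [← Real.exp_add, add_neg_cancel, Real.exp_zero]

section Concentration

variable {U : ℝ} {T : ℕ} {Ω : Type*} [mΩ : MeasurableSpace Ω] {P : Measure Ω}
  (G : Interaction M U T P) {t : ℕ}

open Classical in
/-- The exponent that round `t` contributes at the grid point `x`. -/
def Interaction.increment (l : ℝ) (x : unitInterval) (t : ℕ) (ω : Ω) : ℝ :=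
  if G.crit t ω = x then l * (G.purchase t ω - M.demand x) - l ^ 2 / 8 else 0

variable {G}

/-- The supermartingale step. Whether the critical type is `x` is known at the interim stage; on
that event the factor depends only on the type, which is independent of it, and has mean at most one
by Hoeffding's lemma. Off the event the factor is one. Using `ENNReal` weights avoids any
integrability condition. -/
theorem Interaction.lintegral_mul_increment_le [IsProbabilityMeasure P]
    (hR : M.RegularValuation) (hL : M.LinearInQuality) (h1 : M.typeLaw {1} = 0) (ht : t < T)
    (l : ℝ) (x : unitInterval) {W : Ω → ENNReal} (hW : Measurable[G.ℱ t] W) :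
    ∫⁻ ω, W ω * ENNReal.ofReal (Real.exp (G.increment l x t ω)) ∂P ≤ ∫⁻ ω, W ω ∂P := by
  classical
  set E : Set Ω := G.crit t ⁻¹' {x} with hE
  have hEi : MeasurableSet[G.interim t] E :=
    G.measurable_crit_interim hR hL ht (measurableSet_singleton x)
  have hEm : MeasurableSet E := G.interim_le ht _ hEi
  have hWm : Measurable W := hW.mono (G.ℱ.le t) le_rfl
  set h : unitInterval → ENNReal := fun θ => ENNReal.ofReal (Real.exp
    (l * ((Set.Ici x).indicator (fun _ => 1) θ - M.demand x) - l ^ 2 / 8)) with hh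
  have hhm : Measurable h := by
    have hm : Measurable ((Set.Ici x).indicator fun _ : unitInterval => (1 : ℝ)) :=
      measurable_const.indicator measurableSet_Ici
    exact ((((hm.sub_const _).const_mul l).sub_const _).exp).ennreal_ofReal
  have hWE : Measurable[G.interim t] (E.indicator W) :=
    (hW.mono le_sup_left le_rfl).indicator hEi
  have e1 : ∫⁻ ω, W ω * ENNReal.ofReal (Real.exp (G.increment l x t ω)) ∂P =
      ∫⁻ ω, (Eᶜ.indicator W ω + E.indicator W ω * h (G.type t ω)) ∂P := by
    refine lintegral_congr_ae ?_
    filter_upwards [G.purchase_ae_eq hR h1 ht] with ω hω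
    by_cases hx : G.crit t ω = x
    · have h2 : ω ∈ E := hx
      have h3 : ω ∉ Eᶜ := fun h => h h2
      rw [Set.indicator_of_notMem h3, Set.indicator_of_mem h2, zero_add,
        Interaction.increment, if_pos hx, hω, hx]
    · have h2 : ω ∉ E := hx
      have h3 : ω ∈ Eᶜ := h2
      rw [Set.indicator_of_mem h3, Set.indicator_of_notMem h2, zero_mul, add_zero,
        Interaction.increment, if_neg hx]
      simp
  have e2 := lintegral_mul_eq_lintegral_mul_lintegral_of_independent_measurableSpace
    (G.interim_le ht) (G.type_measurable t ht).comap_le (G.indep_type ht) hWE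
    (hhm.comp (comap_measurable (G.type t)))
  have e3 : ∫⁻ ω, h (G.type t ω) ∂P ≤ 1 := by
    rw [← lintegral_map hhm (G.type_measurable t ht), G.map_type ht]
    exact M.lintegral_exp_indicator_le x l
  rw [e1, lintegral_add_left (hWm.indicator hEm.compl)]
  calc _ = ∫⁻ ω, Eᶜ.indicator W ω ∂P +
        (∫⁻ ω, E.indicator W ω ∂P) * ∫⁻ ω, h (G.type t ω) ∂P := by
        exact congrArg (_ + ·) e2
    _ ≤ ∫⁻ ω, Eᶜ.indicator W ω ∂P + ∫⁻ ω, E.indicator W ω ∂P :=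
        add_le_add_right (mul_le_of_le_one_right' e3) _
    _ = ∫⁻ ω, W ω ∂P := by
        rw [← lintegral_add_left (hWm.indicator hEm.compl)]
        refine lintegral_congr fun ω => ?_
        by_cases h2 : ω ∈ E <;> simp [h2]

theorem Interaction.measurable_increment (hR : M.RegularValuation) (hL : M.LinearInQuality)
    (ht : t < T) (l : ℝ) (x : unitInterval) :
    Measurable[G.ℱ (t + 1)] (G.increment l x t) := by
  classical
  refine Measurable.ite (G.measurable_crit hR hL ht (measurableSet_singleton x)) ?_
    measurable_const
  exact (((G.measurable_purchase ht).sub_const _).const_mul l).sub_const _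

theorem Interaction.measurable_sum_increment (hR : M.RegularValuation)
    (hL : M.LinearInQuality) (ht : t ≤ T) (l : ℝ) (x : unitInterval) :
    Measurable[G.ℱ t] fun ω => ∑ τ ∈ Finset.range t, G.increment l x τ ω := by
  refine Finset.measurable_sum _ fun τ hτ => ?_
  have hτ' := Finset.mem_range.1 hτ
  exact (G.measurable_increment hR hL (by omega) l x).mono (G.ℱ.mono hτ') le_rfl

theorem Interaction.lintegral_exp_sum_increment_le [IsProbabilityMeasure P]
    (hR : M.RegularValuation) (hL : M.LinearInQuality) (h1 : M.typeLaw {1} = 0) (ht : t ≤ T)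
    (l : ℝ) (x : unitInterval) :
    ∫⁻ ω, ENNReal.ofReal (Real.exp (∑ τ ∈ Finset.range t, G.increment l x τ ω)) ∂P ≤ 1 := by
  induction t with
  | zero => simp
  | succ t ih =>
    simp only [Finset.sum_range_succ, Real.exp_add]
    have hm := ((G.measurable_sum_increment hR hL (Nat.le_of_succ_le ht) l x).exp).ennreal_ofReal
    refine le_trans ?_ (ih (Nat.le_of_succ_le ht))
    refine le_trans (le_of_eq ?_) (G.lintegral_mul_increment_le hR hL h1 ht l x hm)
    refine lintegral_congr fun ω => ?_
    rw [ENNReal.ofReal_mul (Real.exp_pos _).le]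

theorem Interaction.sum_increment (l : ℝ) (x : unitInterval) (t : ℕ) (ω : Ω) :
    ∑ τ ∈ Finset.range t, G.increment l x τ ω =
      (G.visits t ω x).card * (l * (G.empDemand t ω x - M.demand x) - l ^ 2 / 8) := by
  classical
  have h2 : ∑ τ ∈ Finset.range t, G.increment l x τ ω =
      ∑ τ ∈ G.visits t ω x, (l * (G.purchase τ ω - M.demand x) - l ^ 2 / 8) := by
    rw [Interaction.visits, Finset.sum_filter]
    exact Finset.sum_congr rfl fun τ _ => by
      unfold Interaction.increment Interaction.crit
      rfl
  have h3 : ∑ τ ∈ G.visits t ω x, G.purchase τ ω =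
      (G.visits t ω x).card * G.empDemand t ω x := by
    rw [Interaction.empDemand, Interaction.count]
    rcases (G.visits t ω x).eq_empty_or_nonempty with h | h
    · simp [h]
    · rw [mul_div_cancel₀ _ (by exact_mod_cast h.card_pos.ne')]
  rw [h2, Finset.sum_sub_distrib, ← Finset.mul_sum, Finset.sum_sub_distrib, h3]
  simp only [Finset.sum_const, nsmul_eq_mul]
  ring

/-- One-sided deviations, with the sign `s` of the deviation. -/
theorem Interaction.measure_deviation_le [IsProbabilityMeasure P]
    (hR : M.RegularValuation) (hL : M.LinearInQuality) (h1 : M.typeLaw {1} = 0) (ht : t ≤ T)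
    (hT : 1 ≤ T) (x : unitInterval) {n : ℕ} (hn : 1 ≤ n) {s : ℝ} (hs : s ^ 2 = 1) :
    P.real {ω | (G.visits t ω x).card = n ∧
      √(16 * Real.log T / n) ≤ s * (G.empDemand t ω x - M.demand x)} ≤ ((T : ℝ) ^ 32)⁻¹ := by
  have hT1 : (1 : ℝ) ≤ T := by exact_mod_cast hT
  have hn1 : (1 : ℝ) ≤ n := by exact_mod_cast hn
  set β := √(16 * Real.log T / n) with hβ
  have hβ2 : n * β ^ 2 = 16 * Real.log T := by
    rw [hβ, Real.sq_sqrt (div_nonneg (by linarith [Real.log_nonneg hT1]) (by linarith))]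
    field_simp
  have hexp : Real.exp (2 * (n * β ^ 2)) = (T : ℝ) ^ 32 := by
    rw [hβ2, ← Real.exp_log (by linarith : (0 : ℝ) < T), ← Real.exp_nat_mul, Real.exp_log
      (by linarith : (0 : ℝ) < T)]
    congr 1
    push_cast
    ring
  -- The parameter `l = 4 * s * β` maximizes `l * (s * β) - l ^ 2 / 8`, with value `2 * β ^ 2`. Over
  -- `n` visits the exponent is thus at least `2 * n * β ^ 2 = 32 * log T`.
  have hm := (((G.measurable_sum_increment hR hL ht (4 * s * β) x).exp).ennreal_ofReal).mono
    (G.ℱ.le t) le_rfl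
  have hmark := mul_meas_ge_le_lintegral (μ := P) hm (ENNReal.ofReal ((T : ℝ) ^ 32))
  have hsub : {ω | (G.visits t ω x).card = n ∧ β ≤ s * (G.empDemand t ω x - M.demand x)} ⊆
      {ω | ENNReal.ofReal ((T : ℝ) ^ 32) ≤
        ENNReal.ofReal (Real.exp (∑ τ ∈ Finset.range t, G.increment (4 * s * β) x τ ω))} := by
    rintro ω ⟨hc, hd⟩
    refine ENNReal.ofReal_le_ofReal ?_
    rw [← hexp, Real.exp_le_exp, G.sum_increment, hc, mul_pow, mul_pow, hs]
    have h0 : 0 ≤ β := Real.sqrt_nonneg _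
    have := mul_le_mul_of_nonneg_left hd h0
    refine (show 2 * (n * β ^ 2) = n * (2 * β ^ 2) by ring).le.trans
      (mul_le_mul_of_nonneg_left ?_ (by linarith))
    nlinarith
  have h2 : ENNReal.ofReal ((T : ℝ) ^ 32) * P {ω | (G.visits t ω x).card = n ∧
      β ≤ s * (G.empDemand t ω x - M.demand x)} ≤ 1 :=
    (mul_le_mul_right (measure_mono hsub) _).trans
      (hmark.trans (G.lintegral_exp_sum_increment_le hR hL h1 ht _ x))
  have h3 := ENNReal.toReal_mono ENNReal.one_ne_top h2
  rw [ENNReal.toReal_mul, ENNReal.toReal_ofReal (by positivity), ENNReal.toReal_one] at h3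
  rw [← one_div, le_div_iff₀' (by positivity)]
  exact h3

/-- The radius depends on the random visit count, so the union bound runs over the counts `1, …, T`
as well as grid types and signs. Count zero has to be excluded: there the radius and the empirical
demand are both `0` by convention. -/
theorem Interaction.measure_not_concentrated_le [IsProbabilityMeasure P]
    (hR : M.RegularValuation) (hL : M.LinearInQuality) (h1 : M.typeLaw {1} = 0) (ht : t ≤ T)
    (hT : 2 ≤ T) (ε : ℝ) (hv : ∀ᵐ ω ∂P, ∀ x ∈ M.typeGrid U ε, (G.visits t ω x).Nonempty) :
    P.real {ω | ¬ G.Concentrated ε t ω} ≤ (M.typeGrid U ε).card / T := by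
  classical
  set E : unitInterval → ℕ → ℝ → Set Ω := fun x n s => {ω | (G.visits t ω x).card = n ∧
      √(16 * Real.log T / n) ≤ s * (G.empDemand t ω x - M.demand x)} with hE
  set I : Finset (unitInterval × ℕ × ℝ) :=
    M.typeGrid U ε ×ˢ Finset.Icc 1 T ×ˢ ({1, -1} : Finset ℝ) with hI
  have hsub : ({ω | ¬ G.Concentrated ε t ω} : Set Ω) ≤ᵐ[P]
      (⋃ i ∈ I, E i.1 i.2.1 i.2.2 : Set Ω) := by
    filter_upwards [hv] with ω hω hbad
    have hbad' : ¬ G.Concentrated ε t ω := hbad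
    unfold Interaction.Concentrated at hbad'
    push Not at hbad'
    obtain ⟨x, hx, hdev⟩ := hbad'
    have hn1 : 1 ≤ (G.visits t ω x).card := (hω x hx).card_pos
    have hn2 : (G.visits t ω x).card ≤ T := (G.count_le t ω x).trans ht
    have hdev' : √(16 * Real.log T / (G.visits t ω x).card) ≤
        |G.empDemand t ω x - M.demand x| := hdev.le
    rcases abs_choice (G.empDemand t ω x - M.demand x) with h | h <;> rw [h] at hdev'
    · exact Set.mem_biUnion (x := (x, (G.visits t ω x).card, (1 : ℝ)))
        (by simp [hI, hx, hn1, hn2]) ⟨rfl, by simpa using hdev'⟩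
    · exact Set.mem_biUnion (x := (x, (G.visits t ω x).card, (-1 : ℝ)))
        (by simp [hI, hx, hn1, hn2]) ⟨rfl, by simpa using hdev'⟩
  have hT2 : (2 : ℝ) ≤ T := by exact_mod_cast hT
  have hcard : (I.card : ℝ) = (M.typeGrid U ε).card * (T * 2) := by
    rw [hI, Finset.card_product, Finset.card_product, Nat.card_Icc,
      Finset.card_pair (by norm_num)]
    push_cast
    simp
  calc P.real {ω | ¬ G.Concentrated ε t ω}
      ≤ P.real (⋃ i ∈ I, E i.1 i.2.1 i.2.2) :=
        ENNReal.toReal_mono (measure_ne_top _ _) (measure_mono_ae hsub)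
    _ ≤ ∑ i ∈ I, P.real (E i.1 i.2.1 i.2.2) := measureReal_biUnion_finset_le _ _
    _ ≤ ∑ _i ∈ I, ((T : ℝ) ^ 32)⁻¹ := by
        refine Finset.sum_le_sum fun i hi => ?_
        simp only [hI, Finset.mem_product, Finset.mem_Icc, Finset.mem_insert,
          Finset.mem_singleton] at hi
        refine G.measure_deviation_le hR hL h1 ht (by omega) i.1 hi.2.1.1 ?_
        rcases hi.2.2 with h | h <;> rw [h] <;> norm_num
    _ = (M.typeGrid U ε).card * ((T * 2) * ((T : ℝ) ^ 32)⁻¹) := by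
        rw [Finset.sum_const, nsmul_eq_mul, hcard]
        ring
    _ ≤ (M.typeGrid U ε).card / T := by
        rw [div_eq_mul_inv]
        refine mul_le_mul_of_nonneg_left ?_ (Nat.cast_nonneg _)
        rw [← div_eq_mul_inv, ← one_div, div_le_div_iff₀ (by positivity) (by linarith), one_mul]
        calc (T : ℝ) * 2 * T ≤ T * T * T := by nlinarith
          _ = (T : ℝ) ^ 3 := by ring
          _ ≤ (T : ℝ) ^ 32 := pow_le_pow_right₀ (by linarith) (by norm_num)

end Concentration

end

end PricingAds

/-! ### Initial rounds, accumulated bonuses and regret -/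

namespace PricingAds

open ProbabilityTheory

noncomputable section

variable {m : ℕ} {M : Market m}

section Rounds

variable {U ε : ℝ} {T : ℕ} {Ω : Type*} [mΩ : MeasurableSpace Ω] {P : Measure Ω}
  {G : Interaction M U T P} {t : ℕ}

/-! ### The initial rounds -/

/-- Without information the announced mean is almost surely the prior mean. The initial rounds then
map injectively into a grid with as many elements as there are rounds, hence onto it. -/
theorem Interaction.visits_nonempty [IsProbabilityMeasure P] (hG : G.FollowsAlgorithm ε)
    (ht : t < T) (hcard : (M.typeGrid U ε).card ≤ t) :
    ∀ᵐ ω ∂P, ∀ x ∈ M.typeGrid U ε, (G.visits t ω x).Nonempty := by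
  classical
  have h1 : ∀ᵐ ω ∂P, ∀ τ < (M.typeGrid U ε).card, G.post τ ω = M.priorMean := by
    rw [ae_all_iff]
    intro τ
    by_cases hτ : τ < (M.typeGrid U ε).card
    · filter_upwards [G.post_ae_eq (by omega) fun ω i => hG.init_noInfo ω τ (by omega) hτ i]
        with ω hω _ using hω
    · exact Filter.Eventually.of_forall fun ω h => absurd h hτ
  filter_upwards [h1] with ω hω x hx
  obtain ⟨τ, hτ, hτx⟩ := Finset.surj_on_of_inj_on_of_card_le
    (s := Finset.range (M.typeGrid U ε).card) (t := M.typeGrid U ε)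
    (fun τ _ => M.criticalType (G.price τ ω) M.priorMean)
    (fun τ hτ => hG.init_grid ω τ (by have := Finset.mem_range.1 hτ; omega)
      (Finset.mem_range.1 hτ))
    (fun τ τ' hτ hτ' h => hG.init_distinct ω
      ⟨by have := Finset.mem_range.1 hτ; omega, Finset.mem_range.1 hτ⟩
      ⟨by have := Finset.mem_range.1 hτ'; omega, Finset.mem_range.1 hτ'⟩ h)
    (by simp) x hx
  have hτ' := Finset.mem_range.1 hτ
  refine ⟨τ, Finset.mem_filter.2 ⟨Finset.mem_range.2 (by omega), ?_⟩⟩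
  rw [hω τ hτ']
  exact hτx.symm

/-! ### Measurability and bounds of the revenue -/

theorem Interaction.measurable_revenue (hR : M.RegularValuation) (hL : M.LinearInQuality)
    (h1 : M.typeLaw {1} = 0) (ht : t < T) :
    Measurable fun ω => M.revenue (G.price t ω) (G.adv t ω) := by
  simp only [hR.revenue_eq h1]
  refine (G.measurable_price ht).mul (Finset.measurable_sum _ fun i _ =>
    Measurable.const_mul ?_ _)
  have hadv : Measurable fun ω => G.adv t ω i :=
    ((measurable_pi_apply i).comp (G.adv_measurable t ht)).mono (G.ℱ.le t) le_rfl
  let κ : Kernel Ω unitInterval := ⟨fun ω => G.adv t ω i, hadv⟩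
  have : IsMarkovKernel κ := ⟨fun ω => (G.adv_feasible t ht ω).1 i⟩
  have hf : Measurable fun z : Ω × unitInterval =>
      M.demand (M.criticalType (G.price t z.1) z.2) :=
    M.antitone_demand.measurable.comp ((hR.continuous_criticalType hL).measurable.comp
      (((G.measurable_price ht).comp measurable_fst).prodMk measurable_snd))
  exact (hf.stronglyMeasurable.integral_kernel_prod_right' (κ := κ)).measurable

theorem Market.revenue_le (hR : M.RegularValuation) (h1 : M.typeLaw {1} = 0) {p : ℝ}
    (hp : 0 ≤ p) {ρ : Fin m → Measure unitInterval} (hρ : M.IsFeasible ρ) :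
    M.revenue p ρ ≤ p := by
  rw [hR.revenue_eq h1]
  refine mul_le_of_le_one_right hp ?_
  rw [← M.prior_sum]
  refine Finset.sum_le_sum fun i _ => mul_le_of_le_one_right (M.prior_nonneg i) ?_
  have := hρ.1 i
  calc _ ≤ ∫ _, (1 : ℝ) ∂(ρ i) := integral_mono_of_nonneg
        (Filter.Eventually.of_forall fun s => M.demand_nonneg _) (integrable_const _)
        (Filter.Eventually.of_forall fun s => M.demand_le_one _)
    _ = 1 := by simp

theorem Interaction.integrable_revenue [IsProbabilityMeasure P] (hR : M.RegularValuation)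
    (hL : M.LinearInQuality) (h1 : M.typeLaw {1} = 0) (ht : t < T) :
    Integrable (fun ω => M.revenue (G.price t ω) (G.adv t ω)) P :=
  integrable_of_abs_le (G.measurable_revenue hR hL h1 ht) (C := U) fun ω => by
    have hp := G.price_mem t ht ω
    rw [abs_of_nonneg (M.revenue_nonneg hp.1 _)]
    exact (M.revenue_le hR h1 hp.1 (G.adv_feasible t ht ω)).trans hp.2

/-! ### The expected bonus of a round -/

theorem Interaction.measurable_confBonus (hR : M.RegularValuation) (hL : M.LinearInQuality)
    (ht : t ≤ T) (x : unitInterval) :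
    Measurable[G.ℱ t] fun ω => confBonus T (G.count t ω x) := by
  classical
  have h1 : Measurable[G.ℱ t] fun ω => G.count t ω x := by
    have h2 : ∀ ω, G.count t ω x =
        ∑ τ ∈ Finset.range t, if G.crit τ ω = x then (1 : ℝ) else 0 := fun ω => by
      rw [Interaction.count, Interaction.visits, Finset.card_filter]
      push_cast
      rfl
    simp only [h2]
    refine Finset.measurable_sum _ fun τ hτ => ?_
    have hτ' := Finset.mem_range.1 hτ
    refine Measurable.ite ?_ measurable_const measurable_const
    exact (G.ℱ.mono hτ') _ (G.measurable_crit hR hL (by omega) (measurableSet_singleton x))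
  have h3 : Measurable (confBonus T) := by
    unfold confBonus
    fun_prop
  exact h3.comp h1

theorem Interaction.confBonus_le_log (hT : 2 ≤ T) (ht : t ≤ T) (ω : Ω) (x : unitInterval) :
    confBonus T (G.count t ω x) ≤ 6 * √(Real.log T) := by
  refine (confBonus_le hT ((G.count_le t ω x).trans ht)).trans ?_
  have h1 : 1 / √((G.visits t ω x).card : ℝ) ≤ 1 := by
    rcases Nat.eq_zero_or_pos (G.visits t ω x).card with h | h
    · simp [h]
    · rw [div_le_one (Real.sqrt_pos.2 (by exact_mod_cast h)), Real.one_le_sqrt]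
      exact_mod_cast h
  have h2 := mul_le_of_le_one_right (Real.sqrt_nonneg (Real.log T)) h1
  linarith

/-- Splitting over the finitely many grid prices replaces the event about the mean, which varies
with the random price, by fixed events to which the conditional law applies. -/
theorem Interaction.hitProb_eq (hG : G.FollowsAlgorithm ε) (ht : t < T)
    (hcard : (M.typeGrid U ε).card ≤ t) (x : unitInterval) (ω : Ω) :
    M.hitProb (G.price t ω) (G.adv t ω) x = ∑ p ∈ priceGrid U ε,
      (G.price t ⁻¹' {p}).indicator (fun _ => 1) ω *
        G.postProb t {q | M.criticalType p q = x} ω := by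
  rw [Finset.sum_eq_single_of_mem _ (hG.candidate ω t ht hcard).1]
  · simp [Market.hitProb, Interaction.postProb]
  · intro p _ hp
    have h : ω ∉ G.price t ⁻¹' {p} := fun h => hp (Set.mem_singleton_iff.1 h).symm
    rw [Set.indicator_of_notMem h, zero_mul]

theorem Interaction.measurable_hitProb (hR : M.RegularValuation) (hG : G.FollowsAlgorithm ε)
    (ht : t < T) (hcard : (M.typeGrid U ε).card ≤ t) (x : unitInterval) :
    Measurable[G.ℱ t] fun ω => M.hitProb (G.price t ω) (G.adv t ω) x := by
  simp only [G.hitProb_eq hG ht hcard x]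
  refine Finset.measurable_sum _ fun p _ => Measurable.mul ?_
    (G.measurable_postProb ht (M.measurableSet_hit hR p x))
  exact measurable_const.indicator (G.price_measurable t ht (measurableSet_singleton p))

theorem Interaction.hitProb_le_one (ht : t < T) (x : unitInterval) (ω : Ω) :
    M.hitProb (G.price t ω) (G.adv t ω) x ≤ 1 :=
  G.postProb_le_one ht _ ω

theorem Interaction.integrable_confBonus_mul_hitProb [IsProbabilityMeasure P]
    (hR : M.RegularValuation) (hL : M.LinearInQuality) (hG : G.FollowsAlgorithm ε)
    (hT : 2 ≤ T) (ht : t < T) (hcard : (M.typeGrid U ε).card ≤ t) (x : unitInterval) :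
    Integrable (fun ω => confBonus T (G.count t ω x) *
      M.hitProb (G.price t ω) (G.adv t ω) x) P := by
  refine integrable_of_abs_le (((G.measurable_confBonus hR hL ht.le x).mul
    (G.measurable_hitProb hR hG ht hcard x)).mono (G.ℱ.le t) le_rfl)
    (C := 6 * √(Real.log T)) fun ω => ?_
  have h1 : 0 ≤ confBonus T (G.count t ω x) := confBonus_nonneg T _
  have h2 := M.hitProb_nonneg (G.price t ω) (G.adv t ω) x
  rw [abs_of_nonneg (mul_nonneg h1 h2)]
  exact (mul_le_of_le_one_right h1 (G.hitProb_le_one ht x ω)).trans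
    (G.confBonus_le_log hT ht.le ω x)

open Classical in
-- The bonus uses only the count before round `t`, so it is a weight known in advance, and the
-- conditional probability of reaching `x` may be exchanged for the indicator that `x` is reached.
theorem Interaction.integral_confBonus_mul_hitProb [IsProbabilityMeasure P]
    (hR : M.RegularValuation) (hL : M.LinearInQuality) (hG : G.FollowsAlgorithm ε)
    (hT : 2 ≤ T) (ht : t < T) (hcard : (M.typeGrid U ε).card ≤ t) (x : unitInterval) :
    ∫ ω, confBonus T (G.count t ω x) * M.hitProb (G.price t ω) (G.adv t ω) x ∂P =
      ∫ ω, confBonus T (G.count t ω x) * (if G.crit t ω = x then 1 else 0) ∂P := by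
  set V : ℝ → Ω → ℝ := fun p ω =>
    confBonus T (G.count t ω x) * (G.price t ⁻¹' {p}).indicator (fun _ => 1) ω with hV
  have hVm : ∀ p, Measurable[G.ℱ t] (V p) := fun p =>
    (G.measurable_confBonus hR hL ht.le x).mul
      (measurable_const.indicator (G.price_measurable t ht (measurableSet_singleton p)))
  have hVb : ∀ p ω, |V p ω| ≤ 6 * √(Real.log T) := fun p ω => by
    have h1 : 0 ≤ confBonus T (G.count t ω x) := confBonus_nonneg T _
    have h2 := G.confBonus_le_log hT ht.le ω x
    simp only [hV, Set.indicator_apply]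
    split_ifs
    · rwa [mul_one, abs_of_nonneg h1]
    · simp
  have hVm' : ∀ p, Measurable (V p) := fun p => (hVm p).mono (G.ℱ.le t) le_rfl
  have hA : ∀ p, MeasurableSet {q | M.criticalType p q = x} := fun p =>
    M.measurableSet_hit hR p x
  have hmul : ∀ (p : ℝ) (f : Ω → ℝ), Measurable f → (∀ ω, |f ω| ≤ 1) →
      Integrable (fun ω => V p ω * f ω) P := fun p f hf hf1 =>
    integrable_of_abs_le ((hVm' p).mul hf) (C := 6 * √(Real.log T)) fun ω => by
      rw [abs_mul]
      exact (mul_le_of_le_one_right (abs_nonneg _) (hf1 ω)).trans (hVb p ω)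
  have e1 : ∀ ω, confBonus T (G.count t ω x) * M.hitProb (G.price t ω) (G.adv t ω) x =
      ∑ p ∈ priceGrid U ε, V p ω * G.postProb t {q | M.criticalType p q = x} ω := fun ω => by
    rw [G.hitProb_eq hG ht hcard x ω, Finset.mul_sum]
    exact Finset.sum_congr rfl fun p _ => by rw [hV, mul_assoc]
  have e2 : ∀ ω, confBonus T (G.count t ω x) * (if G.crit t ω = x then 1 else 0) =
      ∑ p ∈ priceGrid U ε, V p ω *
        (G.post t ⁻¹' {q | M.criticalType p q = x}).indicator (fun _ => 1) ω := fun ω => by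
    rw [Finset.sum_eq_single_of_mem _ (hG.candidate ω t ht hcard).1]
    · simp only [hV, Set.indicator_apply, Set.mem_preimage, Set.mem_singleton_iff, if_true,
        mul_one]
      rfl
    · intro p _ hp
      simp only [hV]
      have h : ω ∉ G.price t ⁻¹' {p} := fun h => hp (Set.mem_singleton_iff.1 h).symm
      rw [Set.indicator_of_notMem h, mul_zero, zero_mul]
  simp only [e1, e2]
  rw [integral_finsetSum, integral_finsetSum]
  · exact Finset.sum_congr rfl fun p _ => G.integral_mul_postProb ht (hVm p) (hVb p) (hA p)
  · exact fun p _ => hmul p _ (measurable_const.indicator (G.measurable_post ht (hA p)))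
      fun ω => by
        rw [Set.indicator_apply]
        split_ifs <;> simp
  · exact fun p _ => hmul p _ ((G.measurable_postProb ht (hA p)).mono (G.ℱ.le t) le_rfl)
      fun ω => by
        rw [abs_of_nonneg (G.postProb_nonneg _ ω)]
        exact G.postProb_le_one ht _ ω

/-! ### Summing the bonuses along a path -/

/-- The difference of roots is the reciprocal of their sum, which is at most `3 * √n` when `n ≥ 1`.
At `n = 0` the left side is `0` by convention, so a first visit costs nothing here. -/
theorem one_div_sqrt_le (n : ℕ) : 1 / √(n : ℝ) ≤ 3 * (√((n : ℝ) + 1) - √(n : ℝ)) := by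
  rcases Nat.eq_zero_or_pos n with rfl | h
  · simp
  have hn : (1 : ℝ) ≤ n := by exact_mod_cast h
  have h1 : 0 < √(n : ℝ) := Real.sqrt_pos.2 (by linarith)
  have h2 : √(n : ℝ) ^ 2 = n := Real.sq_sqrt (by linarith)
  have h3 : √((n : ℝ) + 1) ^ 2 = n + 1 := Real.sq_sqrt (by linarith)
  have h4 : √(n : ℝ) ≤ √((n : ℝ) + 1) := Real.sqrt_le_sqrt (by linarith)
  have h5 : √((n : ℝ) + 1) ≤ 2 * √(n : ℝ) := by
    refine Real.sqrt_le_iff.2 ⟨by positivity, ?_⟩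
    rw [mul_pow, h2]
    linarith
  rw [div_le_iff₀ h1]
  nlinarith

open Classical in
-- Each visit raises the count by one, so the bounds on the bonuses telescope as differences of
-- square roots; `18` is `6 * 3`.
theorem Interaction.sum_confBonus_le (hT : 2 ≤ T) (ht : t ≤ T) (ω : Ω) (x : unitInterval) :
    ∑ τ ∈ Finset.range t, confBonus T (G.count τ ω x) * (if G.crit τ ω = x then 1 else 0) ≤
      18 * √(Real.log T) * √(G.count t ω x) := by
  induction t with
  | zero => simp [Interaction.count, Interaction.visits]
  | succ t ih =>
    rw [Finset.sum_range_succ]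
    have ih' := ih (Nat.le_of_succ_le ht)
    have hcount : G.count (t + 1) ω x = G.count t ω x + if G.crit t ω = x then 1 else 0 := by
      simp only [Interaction.count, Interaction.visits, Finset.range_add_one, Finset.filter_insert]
      change (_ : ℝ) = _ + if M.criticalType (G.price t ω) (G.post t ω) = x then 1 else 0
      split_ifs
      · rw [Finset.card_insert_of_notMem (by simp)]
        push_cast
        rfl
      · simp
    by_cases h : G.crit t ω = x
    · rw [if_pos h] at hcount ⊢
      have h1 := confBonus_le hT ((G.count_le t ω x).trans (Nat.le_of_succ_le ht))
      have h2 := mul_le_mul_of_nonneg_left (one_div_sqrt_le (G.visits t ω x).card)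
        (Real.sqrt_nonneg (Real.log T))
      rw [hcount, mul_one]
      change _ ≤ 18 * √(Real.log T) * √(((G.visits t ω x).card : ℝ) + 1)
      change _ ≤ 18 * √(Real.log T) * √((G.visits t ω x).card : ℝ) at ih'
      change _ + confBonus T ((G.visits t ω x).card : ℝ) ≤ _
      linarith
    · rw [if_neg h, add_zero] at hcount
      rw [if_neg h, mul_zero, add_zero, hcount]
      exact ih'

theorem Interaction.sum_count_le (G : Interaction M U T P) (t : ℕ) (ω : Ω)
    (S : Finset unitInterval) : ∑ x ∈ S, G.count t ω x ≤ t := by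
  classical
  have h1 : ∑ x ∈ S, (G.visits t ω x).card = (S.biUnion fun x => G.visits t ω x).card := by
    refine (Finset.card_biUnion fun x _ y _ hxy => Finset.disjoint_left.2 fun τ hx hy => ?_).symm
    exact hxy ((Finset.mem_filter.1 hx).2.symm.trans (Finset.mem_filter.1 hy).2)
  have h2 : (S.biUnion fun x => G.visits t ω x).card ≤ t := by
    refine (Finset.card_le_card ?_).trans (Finset.card_range t).le
    exact Finset.biUnion_subset.2 fun x _ => Finset.filter_subset _ _
  simp only [Interaction.count]
  rw [← h1] at h2
  exact_mod_cast h2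

open Classical in
theorem Interaction.sum_sum_confBonus_le (hT : 2 ≤ T) (ω : Ω) (S : Finset unitInterval) :
    ∑ t ∈ Finset.range T, ∑ x ∈ S,
      confBonus T (G.count t ω x) * (if G.crit t ω = x then 1 else 0) ≤
      18 * √(Real.log T * (S.card * T)) := by
  rw [Finset.sum_comm]
  have hL : 0 ≤ Real.log T := Real.log_natCast_nonneg T
  -- Cauchy–Schwarz; a round visits only one type, so the counts sum to at most `T`.
  have h1 : ∑ x ∈ S, √(G.count T ω x) ≤ √(S.card * T) := by
    refine Real.le_sqrt_of_sq_le ((sq_sum_le_card_mul_sum_sq).trans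
      (mul_le_mul_of_nonneg_left ?_ (Nat.cast_nonneg _)))
    refine (Finset.sum_congr rfl fun x _ => Real.sq_sqrt (Nat.cast_nonneg _)).le.trans
      (G.sum_count_le T ω S)
  calc _ ≤ ∑ x ∈ S, 18 * √(Real.log T) * √(G.count T ω x) :=
        Finset.sum_le_sum fun x _ => G.sum_confBonus_le hT le_rfl ω x
    _ = 18 * √(Real.log T) * ∑ x ∈ S, √(G.count T ω x) := by rw [Finset.mul_sum]
    _ ≤ 18 * √(Real.log T) * √(S.card * T) := mul_le_mul_of_nonneg_left h1 (by positivity)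
    _ = _ := by rw [mul_assoc, ← Real.sqrt_mul hL]

/-! ### The regret -/

open Classical in
/-- The expected confidence bonus collected in round `t`. -/
def Interaction.expBonus (G : Interaction M U T P) (ε : ℝ) (t : ℕ) : ℝ :=
  ∫ ω, ∑ x ∈ M.typeGrid U ε,
    confBonus T (G.count t ω x) * (if G.crit t ω = x then 1 else 0) ∂P

open Classical in
theorem Interaction.integrable_bonus [IsProbabilityMeasure P] (hR : M.RegularValuation)
    (hL : M.LinearInQuality) (hT : 2 ≤ T) (ht : t < T) (x : unitInterval) :
    Integrable (fun ω => confBonus T (G.count t ω x) * (if G.crit t ω = x then 1 else 0)) P := by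
  have h1 : MeasurableSet {ω | G.crit t ω = x} :=
    (G.ℱ.le _) _ (G.measurable_crit hR hL ht (measurableSet_singleton x))
  refine integrable_of_abs_le (((G.measurable_confBonus hR hL ht.le x).mono (G.ℱ.le t) le_rfl).mul
    (Measurable.ite h1 measurable_const measurable_const)) (C := 6 * √(Real.log T)) fun ω => ?_
  have h2 : 0 ≤ confBonus T (G.count t ω x) := confBonus_nonneg T _
  have h3 := G.confBonus_le_log hT ht.le ω x
  split_ifs
  · rwa [mul_one, abs_of_nonneg h2]
  · simp

theorem Interaction.expBonus_nonneg (ε : ℝ) (t : ℕ) : 0 ≤ G.expBonus ε t := by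
  refine integral_nonneg fun ω => Finset.sum_nonneg fun x _ =>
    mul_nonneg (confBonus_nonneg T _) ?_
  split_ifs <;> norm_num

theorem Interaction.sum_expBonus_le [IsProbabilityMeasure P] (hR : M.RegularValuation)
    (hL : M.LinearInQuality) (hT : 2 ≤ T) (ε : ℝ) :
    ∑ t ∈ Finset.range T, G.expBonus ε t ≤
      18 * √(Real.log T * ((M.typeGrid U ε).card * T)) := by
  classical
  have hint : ∀ t ∈ Finset.range T, Integrable (fun ω => ∑ x ∈ M.typeGrid U ε,
      confBonus T (G.count t ω x) * (if G.crit t ω = x then 1 else 0)) P := fun t ht =>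
    integrable_finsetSum _ fun x _ => G.integrable_bonus hR hL hT (Finset.mem_range.1 ht) x
  unfold Interaction.expBonus
  rw [← integral_finsetSum _ hint]
  calc _ ≤ ∫ _, 18 * √(Real.log T * ((M.typeGrid U ε).card * T)) ∂P :=
        integral_mono (integrable_finsetSum _ hint) (integrable_const _)
          fun ω => G.sum_sum_confBonus_le hT ω _
    _ = _ := by simp

theorem Interaction.late_regret_le [IsProbabilityMeasure P] (hR : M.RegularValuation)
    (hL : M.LinearInQuality) (h1 : M.typeLaw {1} = 0) (hG : G.FollowsAlgorithm ε)
    (hU : 0 < U) (hε : 0 < ε) (hT : 2 ≤ T) (ht : t < T) (hcard : (M.typeGrid U ε).card ≤ t)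
    (Sig : Type*) [MeasurableSpace Sig] :
    M.bestRevenue U Sig - ∫ ω, M.revenue (G.price t ω) (G.adv t ω) ∂P ≤
      2 * ε + U * ((M.typeGrid U ε).card / T) + 2 * U * G.expBonus ε t := by
  classical
  -- The measurable hull has the same measure as the failure event, whose own measurability is then
  -- not needed. On it the loss is bounded by `U`.
  set B := toMeasurable P {ω | ¬ G.Concentrated ε t ω} with hB
  have hBm : MeasurableSet B := measurableSet_toMeasurable _ _
  have hBP : P.real B ≤ (M.typeGrid U ε).card / T := by
    rw [measureReal_def, hB, measure_toMeasurable]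
    exact G.measure_not_concentrated_le hR hL h1 ht.le hT ε (G.visits_nonempty hG ht hcard)
  set F : Ω → ℝ := fun ω => ∑ x ∈ M.typeGrid U ε, confBonus T (G.count t ω x) *
    M.hitProb (G.price t ω) (G.adv t ω) x with hF
  have hFi : Integrable F P := integrable_finsetSum _ fun x _ =>
    G.integrable_confBonus_mul_hitProb hR hL hG hT ht hcard x
  have hFe : ∫ ω, F ω ∂P = G.expBonus ε t := by
    rw [hF, Interaction.expBonus, integral_finsetSum, integral_finsetSum]
    · exact Finset.sum_congr rfl fun x _ =>
        G.integral_confBonus_mul_hitProb hR hL hG hT ht hcard x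
    · exact fun x _ => G.integrable_bonus hR hL hT ht x
    · exact fun x _ => G.integrable_confBonus_mul_hitProb hR hL hG hT ht hcard x
  have hRi := G.integrable_revenue hR hL h1 ht
  have hBi : Integrable (B.indicator fun _ => U) P := (integrable_const U).indicator hBm
  have hpath : ∀ ω, M.bestRevenue U Sig ≤ M.revenue (G.price t ω) (G.adv t ω) +
      (2 * ε + (2 * U * F ω + B.indicator (fun _ => U) ω)) := fun ω => by
    by_cases hω : ω ∈ B
    · have a1 := M.bestRevenue_le hR hL h1 hU.le Sig
      have a2 := M.revenue_nonneg (G.price_mem t ht ω).1 (G.adv t ω)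
      have a3 : 0 ≤ F ω := Finset.sum_nonneg fun x _ =>
        mul_nonneg (confBonus_nonneg T _) (M.hitProb_nonneg _ _ _)
      have a4 : 0 ≤ 2 * U * F ω := by positivity
      rw [Set.indicator_of_mem hω]
      linarith
    · have hc : G.Concentrated ε t ω := by
        by_contra h
        exact hω (subset_toMeasurable _ _ h)
      have := hc.bestRevenue_le hG ht hcard hR hL h1 hU hε Sig
      rw [Set.indicator_of_notMem hω]
      linarith
  have hint := integral_mono (μ := P) (integrable_const (M.bestRevenue U Sig))
    (hRi.add ((integrable_const (2 * ε)).add ((hFi.const_mul (2 * U)).add hBi))) hpath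
  rw [integral_add' hRi ((integrable_const (2 * ε)).add ((hFi.const_mul (2 * U)).add hBi)),
    integral_add' (integrable_const (2 * ε)) ((hFi.const_mul (2 * U)).add hBi),
    integral_add' (hFi.const_mul (2 * U)) hBi, integral_const_mul (2 * U) F, hFe,
    integral_indicator_const _ hBm] at hint
  simp only [integral_const, probReal_univ, smul_eq_mul, one_mul] at hint
  have := mul_le_mul_of_nonneg_left hBP hU.le
  linarith

/-- The regret in terms of the size of the type grid. -/
theorem Interaction.regret_le [IsProbabilityMeasure P] (hR : M.RegularValuation)
    (hL : M.LinearInQuality) (h1 : M.typeLaw {1} = 0) (hG : G.FollowsAlgorithm ε)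
    (hU : 0 < U) (hε : 0 < ε) (hT : 2 ≤ T) (Sig : Type*) [MeasurableSpace Sig] :
    G.regret Sig ≤ 2 * U * (M.typeGrid U ε).card + 2 * ε * T +
      36 * U * √(Real.log T * ((M.typeGrid U ε).card * T)) := by
  classical
  set K := (M.typeGrid U ε).card with hK
  have hround : ∀ t ∈ Finset.range T,
      M.bestRevenue U Sig - ∫ ω, M.revenue (G.price t ω) (G.adv t ω) ∂P ≤
        (if t < K then U else 0) + (2 * ε + U * (K / T) + 2 * U * G.expBonus ε t) := by
    intro t ht
    have ht' := Finset.mem_range.1 ht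
    have hb := G.expBonus_nonneg ε t
    have hb' : 0 ≤ 2 * U * G.expBonus ε t := by positivity
    split_ifs with h
    · have a1 := M.bestRevenue_le hR hL h1 hU.le Sig
      have a2 : 0 ≤ ∫ ω, M.revenue (G.price t ω) (G.adv t ω) ∂P :=
        integral_nonneg fun ω => M.revenue_nonneg (G.price_mem t ht' ω).1 _
      have a3 : 0 ≤ U * ((K : ℝ) / T) := by positivity
      linarith
    · rw [zero_add]
      exact G.late_regret_le hR hL h1 hG hU hε hT ht' (not_lt.1 h) Sig
  have hsplit : G.regret Sig = ∑ t ∈ Finset.range T,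
      (M.bestRevenue U Sig - ∫ ω, M.revenue (G.price t ω) (G.adv t ω) ∂P) := by
    rw [Finset.sum_sub_distrib, Finset.sum_const, Finset.card_range, nsmul_eq_mul]
    rfl
  have hinit : ∑ t ∈ Finset.range T, (if t < K then U else 0) ≤ K * U := by
    rw [← Finset.sum_filter, Finset.sum_const, nsmul_eq_mul]
    refine mul_le_mul_of_nonneg_right ?_ hU.le
    have : (Finset.range T).filter (fun t => t < K) ⊆ Finset.range K := fun t ht =>
      Finset.mem_range.2 (Finset.mem_filter.1 ht).2
    exact_mod_cast (Finset.card_le_card this).trans (Finset.card_range K).le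
  have hbonus := G.sum_expBonus_le hR hL hT ε
  rw [hsplit]
  refine (Finset.sum_le_sum hround).trans ?_
  rw [Finset.sum_add_distrib, Finset.sum_add_distrib, ← Finset.mul_sum, Finset.sum_const,
    Finset.card_range, nsmul_eq_mul]
  have hT0 : (0 : ℝ) < T := by exact_mod_cast (by omega : 0 < T)
  -- Failure probabilities `K / T` over `T` rounds cost `U * K`, as much as the bound for the
  -- initial rounds; together they give `2 * U * K`.
  have e1 : (T : ℝ) * (2 * ε + U * (K / T)) = 2 * ε * T + U * K := by field_simp
  have e2 := mul_le_mul_of_nonneg_left hbonus (by positivity : 0 ≤ 2 * U)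
  rw [e1]
  linarith

theorem Interaction.regret_le_mul [IsProbabilityMeasure P] (hR : M.RegularValuation)
    (hL : M.LinearInQuality) (h1 : M.typeLaw {1} = 0) (hU : 0 ≤ U)
    (Sig : Type*) [MeasurableSpace Sig] : G.regret Sig ≤ T * U := by
  have a1 := M.bestRevenue_le hR hL h1 hU Sig
  have a2 : 0 ≤ ∑ t ∈ Finset.range T, ∫ ω, M.revenue (G.price t ω) (G.adv t ω) ∂P :=
    Finset.sum_nonneg fun t ht => integral_nonneg fun ω =>
      M.revenue_nonneg (G.price_mem t (Finset.mem_range.1 ht) ω).1 _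
  have a3 := mul_le_mul_of_nonneg_left a1 (Nat.cast_nonneg (α := ℝ) T)
  unfold Interaction.regret
  linarith

end Rounds

end

end PricingAds

/-! ### Size of the type grid and choice of the discretization -/

namespace PricingAds

theorem card_typeGrid_mul_le {m : ℕ} (M : Market m) {U ε : ℝ} (hU : 0 ≤ U) (hε : 0 < ε)
    (hε1 : ε ≤ 1) : (M.typeGrid U ε).card * ε ≤ (4 + U) * m := by
  have hm : (1 : ℝ) ≤ m := by exact_mod_cast M.pos_card
  have h1 : ((M.typeGrid U ε).card : ℝ) ≤ ⌊1 / ε⌋₊ + 2 + (⌊U / ε⌋₊ + 1) * m := by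
    exact_mod_cast card_typeGrid_le M U ε
  have h2 : (⌊1 / ε⌋₊ : ℝ) * ε ≤ 1 :=
    (le_div_iff₀ hε).1 (Nat.floor_le (div_nonneg zero_le_one hε.le))
  have h3 : (⌊U / ε⌋₊ : ℝ) * ε ≤ U := (le_div_iff₀ hε).1 (Nat.floor_le (div_nonneg hU hε.le))
  calc ((M.typeGrid U ε).card : ℝ) * ε ≤ (⌊1 / ε⌋₊ + 2 + (⌊U / ε⌋₊ + 1) * m) * ε :=
        mul_le_mul_of_nonneg_right h1 hε.le
    _ = ⌊1 / ε⌋₊ * ε + 2 * ε + (⌊U / ε⌋₊ * ε + ε) * m := by ring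
    _ ≤ 1 + 2 * 1 + (U + 1) * m := by gcongr
    _ ≤ (4 + U) * m := by nlinarith

end PricingAds

open MeasureTheory PricingAds

theorem theorem1 (U c₁ c₂ : ℝ) (hU : 0 < U) (hc₁ : 0 < c₁) (hc₁₂ : c₁ ≤ c₂) :
    ∃ C : ℝ, ∀ (m T : ℕ), 2 ≤ T → ∀ M : Market m,
      M.LinearInQuality → M.RegularValuation → M.typeLaw {1} = 0 →
      ∀ ε : ℝ, c₁ * (m * Real.log T / T) ^ (1 / 3 : ℝ) ≤ ε →
        ε ≤ c₂ * (m * Real.log T / T) ^ (1 / 3 : ℝ) →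
      ∀ (Ω : Type*) [MeasurableSpace Ω] (P : Measure Ω) [IsProbabilityMeasure P]
        (G : Interaction M U T P), G.FollowsAlgorithm ε →
      ∀ (Sig : Type*) [MeasurableSpace Sig],
        G.regret Sig ≤ C * (T : ℝ) ^ (2 / 3 : ℝ) * (m * Real.log T) ^ (1 / 3 : ℝ) := by
  -- In order, the terms pay for the trivial case `ε > 1`, for initial rounds and failure events,
  -- for discretization, and for the bonuses.
  refine ⟨U * c₂ + 4 * U * (4 + U) / c₁ ^ 2 + 2 * c₂ + 36 * U * √((4 + U) / c₁), ?_⟩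
  intro m T hT M hL hR h1 ε hε1 hε2 Ω _ P _ G hG Sig _
  have hT2 : (2 : ℝ) ≤ T := by exact_mod_cast hT
  have hT0 : (0 : ℝ) < T := by linarith
  have hm : (1 : ℝ) ≤ m := by exact_mod_cast M.pos_card
  have hlog : 1 / 2 ≤ Real.log T := by
    have := Real.log_le_log (by norm_num) hT2
    linarith [Real.log_two_gt_d9]
  have hlog0 : 0 < Real.log T := by linarith
  have hc₂ : 0 < c₂ := hc₁.trans_le hc₁₂
  set L := Real.log T with hLdef
  set e : ℝ := (m * L / T) ^ (1 / 3 : ℝ) with he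
  have he0 : 0 < e := Real.rpow_pos_of_pos (by positivity) _
  -- This identity expresses the balance of the two main errors. The target rate is `T * e`, and
  -- every term below is compared with it.
  have he3 : T * e ^ 3 = m * L := by
    rw [he, ← Real.rpow_natCast, ← Real.rpow_mul (by positivity)]
    norm_num
    field_simp
  have hrate : (T : ℝ) ^ (2 / 3 : ℝ) * (m * L) ^ (1 / 3 : ℝ) = T * e := by
    rw [he, Real.div_rpow (by positivity) hT0.le, mul_div_assoc', mul_comm (T : ℝ), mul_div_assoc,
      mul_comm]
    congr 1
    rw [eq_div_iff (Real.rpow_pos_of_pos hT0 _).ne', ← Real.rpow_add hT0]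
    norm_num
  rw [mul_assoc, hrate]
  have hε0 : 0 < ε := (mul_pos hc₁ he0).trans_le hε1
  have hTe : 0 < T * e := by positivity
  have t1 : 0 ≤ U * c₂ * (T * e) := by positivity
  have t2 : 0 ≤ 4 * U * (4 + U) / c₁ ^ 2 * (T * e) := by positivity
  have t3 : 0 ≤ 2 * c₂ * (T * e) := by positivity
  have t4 : 0 ≤ 36 * U * √((4 + U) / c₁) * (T * e) := by positivity
  have hexpand : (U * c₂ + 4 * U * (4 + U) / c₁ ^ 2 + 2 * c₂ + 36 * U * √((4 + U) / c₁)) *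
      (T * e) = U * c₂ * (T * e) + 4 * U * (4 + U) / c₁ ^ 2 * (T * e) + 2 * c₂ * (T * e) +
        36 * U * √((4 + U) / c₁) * (T * e) := by ring
  rw [hexpand]
  -- If `ε > 1` then `c₂ * e ≥ 1`, and the trivial bound `T * U` suffices. Otherwise `ε ≤ 1` is what
  -- the bound on the grid size needs.
  rcases lt_or_ge 1 ε with hbig | hsmall
  · have := G.regret_le_mul hR hL h1 hU.le Sig
    have h2 : 1 ≤ c₂ * e := by linarith
    have h3 : T * U * 1 ≤ T * U * (c₂ * e) := mul_le_mul_of_nonneg_left h2 (by positivity)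
    linarith
  have hreg := G.regret_le hR hL h1 hG hU hε0 hT Sig
  set K : ℝ := ((M.typeGrid U ε).card : ℝ) with hK
  have hK0 : 0 ≤ K := Nat.cast_nonneg _
  have hKe : K * (c₁ * e) ≤ (4 + U) * m :=
    (mul_le_mul_of_nonneg_left hε1 hK0).trans (card_typeGrid_mul_le M hU.le hε0 hsmall)
  have he1 : c₁ * e ≤ 1 := hε1.trans hsmall
  have b1 : 2 * U * K ≤ 4 * U * (4 + U) / c₁ ^ 2 * (T * e) := by
    -- The bound `log T ≥ 1 / 2` supplies the missing logarithm. This gives `K` of order `T * e ^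
    -- 2`, and `c₁ * e ≤ 1` then trades one factor `e` for a constant.
    have hm2 : (m : ℝ) ≤ 2 * (T * e ^ 3) := by
      rw [he3]
      nlinarith
    have h2 : K * (c₁ * e) ≤ (4 + U) * (2 * (T * e ^ 3)) :=
      hKe.trans (mul_le_mul_of_nonneg_left hm2 (by linarith))
    have h3 : K * c₁ ^ 2 ≤ 2 * (4 + U) * (T * e) := by
      have h4 : K * c₁ ≤ (4 + U) * (2 * (T * e ^ 2)) := by
        refine le_of_mul_le_mul_right ?_ he0
        linarith [h2]
      calc K * c₁ ^ 2 = K * c₁ * c₁ := by ring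
        _ ≤ (4 + U) * (2 * (T * e ^ 2)) * c₁ := mul_le_mul_of_nonneg_right h4 hc₁.le
        _ = 2 * (4 + U) * (T * e) * (c₁ * e) := by ring
        _ ≤ 2 * (4 + U) * (T * e) := mul_le_of_le_one_right (by positivity) he1
    have h5 : K ≤ 2 * (4 + U) * (T * e) / c₁ ^ 2 := (le_div_iff₀ (by positivity)).2 h3
    calc 2 * U * K ≤ 2 * U * (2 * (4 + U) * (T * e) / c₁ ^ 2) :=
          mul_le_mul_of_nonneg_left h5 (by positivity)
      _ = _ := by ring
  have b2 : 2 * ε * T ≤ 2 * c₂ * (T * e) := by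
    have := mul_le_mul_of_nonneg_right hε2 hT0.le
    linarith
  have b3 : √(L * (K * T)) ≤ √((4 + U) / c₁) * (T * e) := by
    have h2 : L * (K * T) ≤ (4 + U) / c₁ * (T * e) ^ 2 := by
      refine le_of_mul_le_mul_right ?_ (mul_pos hc₁ he0)
      calc L * (K * T) * (c₁ * e) = L * T * (K * (c₁ * e)) := by ring
        _ ≤ L * T * ((4 + U) * m) := mul_le_mul_of_nonneg_left hKe (by positivity)
        _ = (4 + U) * T * (m * L) := by ring
        _ = (4 + U) / c₁ * (T * e) ^ 2 * (c₁ * e) := by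
          rw [← he3]
          field_simp
    calc √(L * (K * T)) ≤ √((4 + U) / c₁ * (T * e) ^ 2) := Real.sqrt_le_sqrt h2
      _ = √((4 + U) / c₁) * (T * e) := by
        rw [Real.sqrt_mul (by positivity), Real.sqrt_sq hTe.le]
  have b4 := mul_le_mul_of_nonneg_left b3 (by positivity : 0 ≤ 36 * U)
  linarith
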